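/- (Cyclotomic norms.) All rings are commutative with unit. For a ring $R$ and an integer $m\ge 1$, let $\mathbb{W}_m(R)$ be the ring of $m$-truncated big Witt vectors: its underlying set is $\prod_{e\mid m}R$, and its ring structure is the one, functorial in $R$, for which all ghost coordinates $\mathrm{gh}_e(x)=\sum_{d\mid e}d\,x_d^{e/d}$ ($e\mid m$) are ring homomorphisms. For $m\mid m'$ and $d=m'/m$, let $F_d:\mathbb{W}_{m'}(R)\to\mathbb{W}_m(R)$ be the Frobenius (natural in $R$, with $\mathrm{gh}_e(F_d x)=\mathrm{gh}_{de}(x)$) and let $V_d:\mathbb{W}_m(R)\to\mathbb{W}_{m'}(R)$ be the Verschiebung, with $(V_dx)_e=x_{e/d}$ if $d\mid e$ and $(V_dx)_e=0$ otherwise. The $m$-truncated big $q$-Witt vectors of $R$ are $q\text{-}\mathbb{W}_m(R):=\mathbb{W}_m(R)[q]/\mathbb{I}_m$, where $\mathbb{I}_m$ is the ideal generated by the elements $(q^e-1)V_{m/e}(x)$ for $e\mid m$, $x\in\mathbb{W}_e(R)$, and $[e/d]_{q^d}V_{m/e}(x)-V_{m/d}(F_{e/d}(x))$ for $d\mid e\mid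 m$, $x\in\mathbb{W}_e(R)$; here $[k]_{q^d}=1+q^d+\dots+q^{d(k-1)}$. The $q$-ghost map $$q\text{-}\mathrm{gh}: q\text{-}\mathbb{W}_m(R)\longrightarrow\prod_{e\mid m}R[q]/\Phi_e(q)$$ is the $\mathbb{Z}[q]$-algebra map that sends $x\in\mathbb{W}_m(R)$ to $(\mathrm{gh}_{m/e}(x))_{e\mid m}$, where $\Phi_e$ is the $e$-th cyclotomic polynomial. Write $(a,b)$ and $[a,b]$ for the greatest common divisor and the least common multiple of $a$ and $b$. Let $m,m'\ge 1$ be integers with $m\mid m'$. Then there are morphisms of multiplicative monoids $$\Pi_{m'/m}:q\text{-}\mathbb{W}_m(R)\longrightarrow q\text{-}\mathbb{W}_{m'}(R),$$ one for every commutative ring $R$, which are natural in $R$ and are given in $q$-ghost coordinates by $$(c_e(q))_{e\mid m}\longmapsto\Big(c_{(e,m)}\big(q^{e/(e,m)}\big)^{m'/[e,m]}\Big)_{e\mid m'} ,$$ that is, if $c\in q\text{-}\mathbb{W}_m(R)$ has $q$-ghost coordinates $(c_e(q))_{e\mid m}$, then $\Pi_{m'/m}(c)$ has the $q$-ghost coordinates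 on the right-hand side. Moreover, $\Pi_{m'/m}$ is uniquely determined by these two properties: every family of maps $q\text{-}\mathbb{W}_m(R)\to q\text{-}\mathbb{W}_{m'}(R)$ that is natural in $R$ and satisfies this formula on $q$-ghost coordinates for every $R$ coincides with $\Pi_{m'/m}$. -/

import Mathlib

open Polynomial

universe u

namespace BigWitt

section Dwork

variable {A : Type*} [CommRing A]

/-- The ghost expression `∑_{d ∣ e} d * x_d ^ (e / d)`. -/
def ghostSum (x : ℕ → A) (e : ℕ) : A :=
  ∑ d ∈ e.divisors, (d : A) * x d ^ (e / d)

/-- Recursive solution `x` of the system `ghostSum x e = y e` for all `e ≥ 1`, whenever the system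
is solvable step by step (a junk value is chosen otherwise); see `ghostSum_solve`. -/
noncomputable def solve (y : ℕ → A) (e : ℕ) : A :=
  Classical.epsilon fun z : A =>
    (e : A) * z = y e - ∑ d ∈ e.properDivisors.attach, (d.1 : A) * solve y d.1 ^ (e / d.1)
termination_by e
decreasing_by exact (Nat.mem_properDivisors.mp d.2).2

theorem ghostSum_congr {x x' : ℕ → A} {e : ℕ} (h : ∀ d, d ∣ e → x d = x' d) :
    ghostSum x e = ghostSum x' e :=
  Finset.sum_congr rfl fun d hd => by rw [h d (Nat.dvd_of_mem_divisors hd)]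

theorem ghostSum_eq_add (x : ℕ → A) {e : ℕ} (he : e ≠ 0) :
    ghostSum x e = (e : A) * x e + ∑ d ∈ e.properDivisors, (d : A) * x d ^ (e / d) := by
  rw [ghostSum, ← Nat.insert_self_properDivisors he,
    Finset.sum_insert Nat.self_notMem_properDivisors, Nat.div_self (Nat.pos_of_ne_zero he), pow_one]

theorem natCast_dvd_of_prime_pow {n : ℕ} (hn : n ≠ 0) {a : A}
    (h : ∀ p : ℕ, p.Prime → p ∣ n → (p : A) ^ n.factorization p ∣ a) : (n : A) ∣ a := by
  have hprod : (n : A) = ∏ p ∈ n.primeFactors, ((p ^ n.factorization p : ℕ) : A) := by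
    rw [← Nat.cast_prod]
    congr 1
    exact (Nat.prod_factorization_pow_eq_self hn).symm
  rw [hprod]
  apply Finset.prod_dvd_of_coprime
  · intro p hp q hq hpq
    apply Nat.Coprime.cast
    exact Nat.Coprime.pow _ _ ((Nat.coprime_primes (Nat.prime_of_mem_primeFactors hp)
      (Nat.prime_of_mem_primeFactors hq)).mpr hpq)
  · intro p hp
    rw [Nat.cast_pow]
    exact h p (Nat.prime_of_mem_primeFactors hp) (Nat.dvd_of_mem_primeFactors hp)

theorem pow_dvd_pow_sub_pow {p : ℕ} {a b : A} (h : (p : A) ∣ a - b) (k : ℕ) :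
    (p : A) ^ (k.factorization p + 1) ∣ a ^ k - b ^ k := by
  obtain ⟨u, hu⟩ := Nat.ordProj_dvd k p
  have h1 := dvd_sub_pow_of_dvd_sub h (k.factorization p)
  refine h1.trans ?_
  conv_rhs => rw [hu, pow_mul, pow_mul]
  exact sub_dvd_pow_sub_pow _ _ u

theorem ghostSum_dwork {φ : ℕ → A →+* A}
    (hφ : ∀ p : ℕ, p.Prime → ∀ a, (p : A) ∣ a ^ p - φ p a) (x : ℕ → A) {p e : ℕ}
    (hp : p.Prime) (he : e ≠ 0) (hpe : p ∣ e) :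
    (p : A) ^ e.factorization p ∣ ghostSum x e - φ p (ghostSum x (e / p)) := by
  obtain ⟨f, rfl⟩ := hpe
  have hf : f ≠ 0 := by rintro rfl; simp at he
  rw [Nat.mul_div_cancel_left _ hp.pos]
  have hsub : f.divisors ⊆ (p * f).divisors :=
    Nat.divisors_subset_of_dvd he (Dvd.intro_left p rfl)
  have hfac : (p * f).factorization p = f.factorization p + 1 := by
    rw [Nat.factorization_mul hp.ne_zero hf, Finsupp.add_apply, hp.factorization_self, add_comm]
  have key : ghostSum x (p * f) - φ p (ghostSum x f) =
      ∑ d ∈ (p * f).divisors \ f.divisors, (d : A) * x d ^ (p * f / d) +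
      ∑ d ∈ f.divisors, (d : A) * ((x d ^ p) ^ (f / d) - φ p (x d) ^ (f / d)) := by
    simp only [ghostSum, map_sum, map_mul, map_pow, map_natCast, mul_sub, Finset.sum_sub_distrib]
    rw [← Finset.sum_sdiff hsub, add_sub_assoc]
    congr 2
    refine Finset.sum_congr rfl fun d hd => ?_
    rw [← pow_mul, Nat.mul_div_assoc _ (Nat.dvd_of_mem_divisors hd)]
  rw [key]
  refine dvd_add (Finset.dvd_sum fun d hd => ?_) (Finset.dvd_sum fun d hd => ?_)
  · rw [Finset.mem_sdiff, Nat.mem_divisors, Nat.mem_divisors] at hd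
    obtain ⟨⟨hd1, -⟩, hd2⟩ := hd
    refine Dvd.dvd.mul_right ?_ _
    rw [← Nat.cast_pow]
    apply Nat.cast_dvd_cast
    have hd0 : d ≠ 0 := by rintro rfl; exact he (Nat.eq_zero_of_zero_dvd hd1)
    rw [hp.pow_dvd_iff_le_factorization hd0, hfac]
    by_contra hlt
    apply hd2
    refine ⟨?_, hf⟩
    rw [← Nat.factorization_le_iff_dvd hd0 hf]
    intro r
    have h1 := (Nat.factorization_le_iff_dvd hd0 he).mpr hd1 r
    rw [Nat.factorization_mul hp.ne_zero hf, Finsupp.add_apply, hp.factorization] at h1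
    by_cases hr : r = p
    · subst hr; omega
    · simpa [Finsupp.single_apply, Ne.symm hr] using h1
  · have hdf := Nat.dvd_of_mem_divisors hd
    obtain ⟨k, rfl⟩ := hdf
    have hd0 : d ≠ 0 := left_ne_zero_of_mul hf
    have hk0 : k ≠ 0 := right_ne_zero_of_mul hf
    rw [hfac, Nat.mul_div_cancel_left _ (Nat.pos_of_ne_zero hd0), Nat.factorization_mul hd0 hk0,
      Finsupp.add_apply, add_assoc, pow_add]
    refine mul_dvd_mul ?_ (pow_dvd_pow_sub_pow (hφ p hp _) k)
    rw [← Nat.cast_pow]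
    exact Nat.cast_dvd_cast (Nat.ordProj_dvd d p)

/-- Dwork's lemma (existence of a solution in the presence of Frobenius lifts). -/
theorem ghostSum_solve {φ : ℕ → A →+* A}
    (hφ : ∀ p : ℕ, p.Prime → ∀ a, (p : A) ∣ a ^ p - φ p a) {y : ℕ → A}
    (hy : ∀ p e : ℕ, p.Prime → e ≠ 0 → p ∣ e →
      (p : A) ^ e.factorization p ∣ y e - φ p (y (e / p))) {e : ℕ} (he : e ≠ 0) :
    ghostSum (solve y) e = y e := by
  induction e using Nat.strong_induction_on with
  | _ e ih =>
  have hex : ∃ z : A, (e : A) * z =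
      y e - ∑ d ∈ e.properDivisors.attach, (d.1 : A) * solve y d.1 ^ (e / d.1) := by
    rw [Finset.sum_attach e.properDivisors fun d => (d : A) * solve y d ^ (e / d)]
    suffices h : (e : A) ∣ y e - ∑ d ∈ e.properDivisors, (d : A) * solve y d ^ (e / d) by
      obtain ⟨z, hz⟩ := h
      exact ⟨z, hz.symm⟩
    refine natCast_dvd_of_prime_pow he fun p hp hpe => ?_
    have hlt : e / p < e := Nat.div_lt_self (Nat.pos_of_ne_zero he) hp.one_lt
    have hne : e / p ≠ 0 :=
      (Nat.div_pos (Nat.le_of_dvd (Nat.pos_of_ne_zero he) hpe) hp.pos).ne'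
    have h1 := ghostSum_dwork hφ (Function.update (solve y) e 0) hp he hpe
    have h2 : ghostSum (Function.update (solve y) e 0) (e / p) = y (e / p) := by
      rw [← ih _ hlt hne]
      refine ghostSum_congr fun d hd => ?_
      rw [Function.update_of_ne]
      exact ((Nat.le_of_dvd (Nat.pos_of_ne_zero hne) hd).trans_lt hlt).ne
    have h3 : ghostSum (Function.update (solve y) e 0) e =
        ∑ d ∈ e.properDivisors, (d : A) * solve y d ^ (e / d) := by
      rw [ghostSum_eq_add _ he, Function.update_self, mul_zero, zero_add]
      refine Finset.sum_congr rfl fun d hd => ?_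
      rw [Function.update_of_ne (Nat.mem_properDivisors.mp hd).2.ne]
    rw [h2, h3] at h1
    have h4 := dvd_sub (hy p e hp he hpe) h1
    rwa [sub_sub_sub_cancel_right] at h4
  have h := Classical.epsilon_spec hex
  rw [ghostSum_eq_add _ he]
  conv_lhs => enter [1, 2]; rw [solve]
  rw [h, Finset.sum_attach e.properDivisors fun d => (d : A) * solve y d ^ (e / d),
    sub_add_cancel]

theorem map_ghostSum {B : Type*} [CommRing B] (f : A →+* B) (x : ℕ → A) (e : ℕ) :
    f (ghostSum x e) = ghostSum (fun d => f (x d)) e := by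
  simp [ghostSum]

theorem ghostSum_injective [IsDomain A] [CharZero A] {x x' : ℕ → A} {m : ℕ}
    (h : ∀ e ∈ m.divisors, ghostSum x e = ghostSum x' e) : ∀ e ∈ m.divisors, x e = x' e := by
  intro e
  induction e using Nat.strong_induction_on with
  | _ e ih =>
  intro hem
  have he : e ≠ 0 := (Nat.pos_of_mem_divisors hem).ne'
  have h1 := h e hem
  rw [ghostSum_eq_add _ he, ghostSum_eq_add _ he] at h1
  have h2 : ∑ d ∈ e.properDivisors, (d : A) * x d ^ (e / d) =
      ∑ d ∈ e.properDivisors, (d : A) * x' d ^ (e / d) := by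
    refine Finset.sum_congr rfl fun d hd => ?_
    rw [Nat.mem_properDivisors] at hd
    rw [ih d hd.2 (Nat.mem_divisors.mpr
      ⟨hd.1.trans (Nat.dvd_of_mem_divisors hem), (Nat.mem_divisors.mp hem).2⟩)]
  rw [h2] at h1
  exact mul_left_cancel₀ (Nat.cast_ne_zero.mpr he) (add_right_cancel h1)

end Dwork

section Polynomials

variable {σ : Type*}

theorem expand_frobenius (p : ℕ) (hp : p.Prime) (a : MvPolynomial σ ℤ) :
    (p : MvPolynomial σ ℤ) ∣ a ^ p - (MvPolynomial.expand p : _ →ₐ[ℤ] _).toRingHom a := by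
  have := Fact.mk hp
  rw [← map_natCast (MvPolynomial.C : ℤ →+* MvPolynomial σ ℤ), MvPolynomial.C_dvd_iff_zmod]
  simp [MvPolynomial.map_expand, MvPolynomial.expand_zmod]

/-- Universal polynomials of the addition of big Witt vectors. -/
noncomputable def addPoly : ℕ → MvPolynomial (Bool × ℕ) ℤ :=
  solve fun e => ghostSum (fun d => MvPolynomial.X (false, d)) e +
    ghostSum (fun d => MvPolynomial.X (true, d)) e

/-- Universal polynomials of the multiplication of big Witt vectors. -/
noncomputable def mulPoly : ℕ → MvPolynomial (Bool × ℕ) ℤ :=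
  solve fun e => ghostSum (fun d => MvPolynomial.X (false, d)) e *
    ghostSum (fun d => MvPolynomial.X (true, d)) e

/-- Universal polynomials of the negation of big Witt vectors. -/
noncomputable def negPoly : ℕ → MvPolynomial ℕ ℤ :=
  solve fun e => -ghostSum MvPolynomial.X e

/-- Universal polynomials of the `d`-th Frobenius of big Witt vectors. -/
noncomputable def frobPoly (d : ℕ) : ℕ → MvPolynomial ℕ ℤ :=
  solve fun e => ghostSum MvPolynomial.X (d * e)

theorem ghostSum_addPoly {e : ℕ} (he : e ≠ 0) :
    ghostSum addPoly e = ghostSum (fun d => MvPolynomial.X (false, d)) e +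
      ghostSum (fun d => MvPolynomial.X (true, d)) e := by
  refine ghostSum_solve expand_frobenius (fun p e hp he hpe => ?_) he
  rw [map_add, add_sub_add_comm]
  exact dvd_add (ghostSum_dwork expand_frobenius _ hp he hpe)
    (ghostSum_dwork expand_frobenius _ hp he hpe)

theorem ghostSum_mulPoly {e : ℕ} (he : e ≠ 0) :
    ghostSum mulPoly e = ghostSum (fun d => MvPolynomial.X (false, d)) e *
      ghostSum (fun d => MvPolynomial.X (true, d)) e := by
  refine ghostSum_solve expand_frobenius (fun p e hp he hpe => ?_) he
  have h (a b a' b' : MvPolynomial (Bool × ℕ) ℤ) :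
      a * b - a' * b' = (a - a') * b + a' * (b - b') := by ring
  rw [map_mul, h]
  exact dvd_add ((ghostSum_dwork expand_frobenius _ hp he hpe).mul_right _)
    ((ghostSum_dwork expand_frobenius _ hp he hpe).mul_left _)

theorem ghostSum_negPoly {e : ℕ} (he : e ≠ 0) :
    ghostSum negPoly e = -ghostSum MvPolynomial.X e := by
  refine ghostSum_solve expand_frobenius (fun p e hp he hpe => ?_) he
  rw [map_neg, ← neg_sub']
  exact (ghostSum_dwork expand_frobenius _ hp he hpe).neg_right

theorem ghostSum_frobPoly {d : ℕ} (hd : d ≠ 0) {e : ℕ} (he : e ≠ 0) :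
    ghostSum (frobPoly d) e = ghostSum MvPolynomial.X (d * e) := by
  refine ghostSum_solve expand_frobenius (fun p e hp he hpe => ?_) he
  have h := ghostSum_dwork expand_frobenius (MvPolynomial.X : ℕ → MvPolynomial ℕ ℤ) hp
    (mul_ne_zero hd he) (hpe.mul_left d)
  rw [Nat.mul_div_assoc _ hpe] at h
  refine (pow_dvd_pow _ ?_).trans h
  rw [Nat.factorization_mul hd he, Finsupp.add_apply]
  exact Nat.le_add_left _ _

end Polynomials

end BigWitt

/-- The `m`-truncated big Witt vectors of `R`, `m ≥ 1`: families `(x_e)_{e ∣ m}` of elements of `R`,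
with the ring structure given by the universal integral polynomials that make the ghost map
`x ↦ (∑_{d ∣ e} d * x_d ^ (e / d))_{e ∣ m}` a ring homomorphism for every commutative ring `R`. -/
@[ext]
structure BigWitt (m : ℕ) (R : Type*) where
  /-- The Witt coordinates. -/
  toFun : m.divisors → R

namespace BigWitt

variable {m : ℕ} {R S : Type*} [CommRing R] [CommRing S]

/-- The Witt coordinates, extended by `0` to all natural numbers. -/
def coeff (x : BigWitt m R) (e : ℕ) : R :=
  if h : e ∈ m.divisors then x.toFun ⟨e, h⟩ else 0

/-- The big Witt vector with Witt coordinates `(f e)_{e ∣ m}`. -/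
def ofFun (m : ℕ) (f : ℕ → R) : BigWitt m R := ⟨fun e => f e⟩

theorem coeff_ofFun (f : ℕ → R) {e : ℕ} (he : e ∈ m.divisors) : (ofFun m f).coeff e = f e := by
  simp only [coeff, ofFun, dif_pos he]

theorem ext_coeff {x y : BigWitt m R} (h : ∀ e ∈ m.divisors, x.coeff e = y.coeff e) : x = y := by
  ext ⟨e, he⟩
  simpa only [coeff, dif_pos he] using h e he

/-- The `e`-th ghost coordinate, for `e ∣ m`. -/
def ghost (x : BigWitt m R) (e : ℕ) : R := ghostSum x.coeff e

theorem ghost_ofFun (f : ℕ → R) {e : ℕ} (he : e ∈ m.divisors) :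
    (ofFun m f).ghost e = ghostSum f e :=
  ghostSum_congr fun _ hd => coeff_ofFun f (Nat.mem_divisors.mpr
    ⟨hd.trans (Nat.dvd_of_mem_divisors he), (Nat.mem_divisors.mp he).2⟩)

theorem ext_ghost [IsDomain R] [CharZero R] {x y : BigWitt m R}
    (h : ∀ e ∈ m.divisors, x.ghost e = y.ghost e) : x = y :=
  ext_coeff (ghostSum_injective h)

/-- The variables of the two-variable structure polynomials, specialised to two Witt vectors. -/
def pair (x y : BigWitt m R) (i : Bool × ℕ) : R := bif i.1 then y.coeff i.2 else x.coeff i.2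

instance : Zero (BigWitt m R) := ⟨ofFun m fun _ => 0⟩

instance : One (BigWitt m R) := ⟨ofFun m fun e => if e = 1 then 1 else 0⟩

noncomputable instance : Add (BigWitt m R) :=
  ⟨fun x y => ofFun m fun e => MvPolynomial.aeval (pair x y) (addPoly e)⟩

noncomputable instance : Mul (BigWitt m R) :=
  ⟨fun x y => ofFun m fun e => MvPolynomial.aeval (pair x y) (mulPoly e)⟩

noncomputable instance : Neg (BigWitt m R) :=
  ⟨fun x => ofFun m fun e => MvPolynomial.aeval x.coeff (negPoly e)⟩

theorem ghostSum_aeval {σ : Type*} (v : σ → R) (P : ℕ → MvPolynomial σ ℤ) (e : ℕ) :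
    ghostSum (fun d => MvPolynomial.aeval v (P d)) e = MvPolynomial.aeval v (ghostSum P e) :=
  (map_ghostSum (MvPolynomial.aeval v : MvPolynomial σ ℤ →ₐ[ℤ] R).toRingHom P e).symm

theorem ne_zero_of_mem {e : ℕ} (he : e ∈ m.divisors) : e ≠ 0 := (Nat.pos_of_mem_divisors he).ne'

theorem ghost_zero {e : ℕ} (he : e ∈ m.divisors) : (0 : BigWitt m R).ghost e = 0 := by
  refine (ghost_ofFun _ he).trans (Finset.sum_eq_zero fun d hd => ?_)
  rw [zero_pow, mul_zero]
  exact (Nat.div_pos (Nat.divisor_le hd) (Nat.pos_of_mem_divisors hd)).ne'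

theorem ghost_one {e : ℕ} (he : e ∈ m.divisors) : (1 : BigWitt m R).ghost e = 1 := by
  refine (ghost_ofFun _ he).trans ?_
  rw [ghostSum, Finset.sum_eq_single 1]
  · simp
  · intro d hd h1
    rw [if_neg h1, zero_pow, mul_zero]
    exact (Nat.div_pos (Nat.divisor_le hd) (Nat.pos_of_mem_divisors hd)).ne'
  · intro h
    exact absurd (Nat.one_mem_divisors.mpr (ne_zero_of_mem he)) h

theorem ghost_add (x y : BigWitt m R) {e : ℕ} (he : e ∈ m.divisors) :
    (x + y).ghost e = x.ghost e + y.ghost e := by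
  refine (ghost_ofFun _ he).trans ?_
  rw [ghostSum_aeval, ghostSum_addPoly (ne_zero_of_mem he), map_add, ← ghostSum_aeval,
    ← ghostSum_aeval]
  simp [pair, ghost]

theorem ghost_mul (x y : BigWitt m R) {e : ℕ} (he : e ∈ m.divisors) :
    (x * y).ghost e = x.ghost e * y.ghost e := by
  refine (ghost_ofFun _ he).trans ?_
  rw [ghostSum_aeval, ghostSum_mulPoly (ne_zero_of_mem he), map_mul, ← ghostSum_aeval,
    ← ghostSum_aeval]
  simp [pair, ghost]

theorem ghost_neg (x : BigWitt m R) {e : ℕ} (he : e ∈ m.divisors) :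
    (-x).ghost e = -x.ghost e := by
  refine (ghost_ofFun _ he).trans ?_
  rw [ghostSum_aeval, ghostSum_negPoly (ne_zero_of_mem he), map_neg, ← ghostSum_aeval]
  simp [ghost]

/-- The map on big Witt vectors induced by a ring homomorphism, as a function. -/
def mapFun (f : R →+* S) (x : BigWitt m R) : BigWitt m S := ⟨fun e => f (x.toFun e)⟩

theorem coeff_mapFun (f : R →+* S) (x : BigWitt m R) (e : ℕ) :
    (mapFun f x).coeff e = f (x.coeff e) := by
  unfold coeff mapFun
  split_ifs <;> simp

theorem mapFun_ofFun (f : R →+* S) (g : ℕ → R) :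
    mapFun f (ofFun m g) = ofFun m fun e => f (g e) := rfl

theorem map_aeval_int {σ : Type*} (f : R →+* S) (v : σ → R) (P : MvPolynomial σ ℤ) :
    f (MvPolynomial.aeval v P) = MvPolynomial.aeval (fun i => f (v i)) P :=
  DFunLike.congr_fun (MvPolynomial.comp_aeval v f.toIntAlgHom) P

theorem mapFun_zero (f : R →+* S) : mapFun f (0 : BigWitt m R) = 0 := by
  refine (mapFun_ofFun f _).trans ?_
  simp only [map_zero]
  rfl

theorem mapFun_one (f : R →+* S) : mapFun f (1 : BigWitt m R) = 1 := by
  refine (mapFun_ofFun f _).trans ?_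
  simp only [apply_ite f, map_zero, map_one]
  rfl

theorem map_pair (f : R →+* S) (x y : BigWitt m R) :
    (fun i => f (pair x y i)) = pair (mapFun f x) (mapFun f y) := by
  funext ⟨b, i⟩
  cases b <;> simp [pair, coeff_mapFun]

theorem mapFun_add (f : R →+* S) (x y : BigWitt m R) :
    mapFun f (x + y) = mapFun f x + mapFun f y := by
  refine (mapFun_ofFun f _).trans ?_
  simp only [map_aeval_int, map_pair]
  rfl

theorem mapFun_mul (f : R →+* S) (x y : BigWitt m R) :
    mapFun f (x * y) = mapFun f x * mapFun f y := by
  refine (mapFun_ofFun f _).trans ?_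
  simp only [map_aeval_int, map_pair]
  rfl

theorem mapFun_neg (f : R →+* S) (x : BigWitt m R) : mapFun f (-x) = -mapFun f x := by
  refine (mapFun_ofFun f _).trans ?_
  simp only [map_aeval_int, ← coeff_mapFun]
  rfl

/-- The tautological surjection onto `R` from a polynomial ring over `ℤ`. -/
noncomputable def cover (R : Type*) [CommRing R] : MvPolynomial R ℤ →+* R :=
  (MvPolynomial.aeval (fun r : R => r) : MvPolynomial R ℤ →ₐ[ℤ] R).toRingHom

theorem mapFun_cover_surjective :
    Function.Surjective (mapFun (cover R) : BigWitt m (MvPolynomial R ℤ) → BigWitt m R) := by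
  intro x
  refine ⟨⟨fun e => MvPolynomial.X (x.toFun e)⟩, ?_⟩
  ext e
  simp [mapFun, cover]

theorem mapFun_cover_congr {x y : BigWitt m (MvPolynomial R ℤ)}
    (h : ∀ e ∈ m.divisors, x.ghost e = y.ghost e) : mapFun (cover R) x = mapFun (cover R) y :=
  congrArg _ (ext_ghost h)

noncomputable instance : CommRing (BigWitt m R) where
  add_assoc x y z := by
    obtain ⟨x, rfl⟩ := mapFun_cover_surjective x
    obtain ⟨y, rfl⟩ := mapFun_cover_surjective y
    obtain ⟨z, rfl⟩ := mapFun_cover_surjective z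
    simp only [← mapFun_add]
    exact mapFun_cover_congr fun e he => by simp only [ghost_add _ _ he, add_assoc]
  zero_add x := by
    obtain ⟨x, rfl⟩ := mapFun_cover_surjective x
    simp only [← mapFun_zero (cover R), ← mapFun_add]
    exact mapFun_cover_congr fun e he => by simp only [ghost_add _ _ he, ghost_zero he, zero_add]
  add_zero x := by
    obtain ⟨x, rfl⟩ := mapFun_cover_surjective x
    simp only [← mapFun_zero (cover R), ← mapFun_add]
    exact mapFun_cover_congr fun e he => by simp only [ghost_add _ _ he, ghost_zero he, add_zero]
  nsmul := nsmulRec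
  zsmul := zsmulRec
  neg_add_cancel x := by
    obtain ⟨x, rfl⟩ := mapFun_cover_surjective x
    simp only [← mapFun_zero (cover R), ← mapFun_add, ← mapFun_neg]
    exact mapFun_cover_congr fun e he => by
      simp only [ghost_add _ _ he, ghost_neg _ he, ghost_zero he, neg_add_cancel]
  add_comm x y := by
    obtain ⟨x, rfl⟩ := mapFun_cover_surjective x
    obtain ⟨y, rfl⟩ := mapFun_cover_surjective y
    simp only [← mapFun_add]
    exact mapFun_cover_congr fun e he => by simp only [ghost_add _ _ he, add_comm]
  left_distrib x y z := by
    obtain ⟨x, rfl⟩ := mapFun_cover_surjective x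
    obtain ⟨y, rfl⟩ := mapFun_cover_surjective y
    obtain ⟨z, rfl⟩ := mapFun_cover_surjective z
    simp only [← mapFun_add, ← mapFun_mul]
    exact mapFun_cover_congr fun e he => by simp only [ghost_add _ _ he, ghost_mul _ _ he, mul_add]
  right_distrib x y z := by
    obtain ⟨x, rfl⟩ := mapFun_cover_surjective x
    obtain ⟨y, rfl⟩ := mapFun_cover_surjective y
    obtain ⟨z, rfl⟩ := mapFun_cover_surjective z
    simp only [← mapFun_add, ← mapFun_mul]
    exact mapFun_cover_congr fun e he => by simp only [ghost_add _ _ he, ghost_mul _ _ he, add_mul]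
  zero_mul x := by
    obtain ⟨x, rfl⟩ := mapFun_cover_surjective x
    simp only [← mapFun_zero (cover R), ← mapFun_mul]
    exact mapFun_cover_congr fun e he => by simp only [ghost_mul _ _ he, ghost_zero he, zero_mul]
  mul_zero x := by
    obtain ⟨x, rfl⟩ := mapFun_cover_surjective x
    simp only [← mapFun_zero (cover R), ← mapFun_mul]
    exact mapFun_cover_congr fun e he => by simp only [ghost_mul _ _ he, ghost_zero he, mul_zero]
  mul_assoc x y z := by
    obtain ⟨x, rfl⟩ := mapFun_cover_surjective x
    obtain ⟨y, rfl⟩ := mapFun_cover_surjective y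
    obtain ⟨z, rfl⟩ := mapFun_cover_surjective z
    simp only [← mapFun_mul]
    exact mapFun_cover_congr fun e he => by simp only [ghost_mul _ _ he, mul_assoc]
  one_mul x := by
    obtain ⟨x, rfl⟩ := mapFun_cover_surjective x
    simp only [← mapFun_one (cover R), ← mapFun_mul]
    exact mapFun_cover_congr fun e he => by simp only [ghost_mul _ _ he, ghost_one he, one_mul]
  mul_one x := by
    obtain ⟨x, rfl⟩ := mapFun_cover_surjective x
    simp only [← mapFun_one (cover R), ← mapFun_mul]
    exact mapFun_cover_congr fun e he => by simp only [ghost_mul _ _ he, ghost_one he, mul_one]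
  mul_comm x y := by
    obtain ⟨x, rfl⟩ := mapFun_cover_surjective x
    obtain ⟨y, rfl⟩ := mapFun_cover_surjective y
    simp only [← mapFun_mul]
    exact mapFun_cover_congr fun e he => by simp only [ghost_mul _ _ he, mul_comm]

/-- The ring homomorphism on big Witt vectors induced by a ring homomorphism, coordinatewise in
Witt coordinates. -/
noncomputable def map (m : ℕ) (f : R →+* S) : BigWitt m R →+* BigWitt m S where
  toFun := mapFun f
  map_zero' := mapFun_zero f
  map_one' := mapFun_one f
  map_add' := mapFun_add f
  map_mul' := mapFun_mul f

/-- The `e`-th ghost coordinate, for `e ∣ m`, as a ring homomorphism. -/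
noncomputable def ghostHom (R : Type*) [CommRing R] {m e : ℕ} (he : e ∈ m.divisors) :
    BigWitt m R →+* R where
  toFun x := x.ghost e
  map_zero' := ghost_zero he
  map_one' := ghost_one he
  map_add' x y := ghost_add x y he
  map_mul' x y := ghost_mul x y he

/-- The Frobenius `F_{n/m} : W_n(R) → W_m(R)`, for `m ∣ n`. It is given by the universal polynomials
for which the `e`-th ghost coordinate of the image of `x` is the `(n/m) * e`-th ghost coordinate
of `x`. -/
noncomputable def frobenius (m n : ℕ) (x : BigWitt n R) : BigWitt m R :=
  ofFun m fun e => MvPolynomial.aeval x.coeff (frobPoly (n / m) e)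

/-- The Verschiebung `V_{n/m} : W_m(R) → W_n(R)`, for `m ∣ n`: the `e`-th Witt coordinate of the
image of `x` is `x_{e / (n/m)}` if `n/m` divides `e`, and `0` otherwise. -/
def verschiebung (m n : ℕ) (x : BigWitt m R) : BigWitt n R :=
  ofFun n fun e => if n / m ∣ e then x.coeff (e / (n / m)) else 0

theorem ghost_frobenius {m n : ℕ} (hmn : m ∣ n) (hn : n ≠ 0) (x : BigWitt n R) {e : ℕ}
    (he : e ∈ m.divisors) : (frobenius m n x).ghost e = x.ghost (n / m * e) := by
  have hd : n / m ≠ 0 := (Nat.div_pos (Nat.le_of_dvd (Nat.pos_of_ne_zero hn) hmn)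
    (Nat.pos_of_dvd_of_pos hmn (Nat.pos_of_ne_zero hn))).ne'
  refine (ghost_ofFun _ he).trans ?_
  rw [ghostSum_aeval, ghostSum_frobPoly hd (ne_zero_of_mem he), ← ghostSum_aeval]
  simp [ghost]

theorem ghost_verschiebung {m n : ℕ} (hmn : m ∣ n) (x : BigWitt m R) {e : ℕ}
    (he : e ∈ n.divisors) : (verschiebung m n x).ghost e =
      if n / m ∣ e then ((n / m : ℕ) : R) * x.ghost (e / (n / m)) else 0 := by
  have hn := (Nat.mem_divisors.mp he).2
  have hd : 0 < n / m := Nat.div_pos (Nat.le_of_dvd (Nat.pos_of_ne_zero hn) hmn)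
    (Nat.pos_of_dvd_of_pos hmn (Nat.pos_of_ne_zero hn))
  refine (ghost_ofFun _ he).trans ?_
  generalize n / m = d at hd
  have hterm : ∀ k ∈ e.divisors, ¬ d ∣ k →
      (k : R) * (if d ∣ k then x.coeff (k / d) else 0) ^ (e / k) = 0 := by
    intro k hk hdk
    rw [if_neg hdk, zero_pow, mul_zero]
    exact (Nat.div_pos (Nat.divisor_le hk) (Nat.pos_of_mem_divisors hk)).ne'
  split_ifs with hde
  · obtain ⟨f, rfl⟩ := hde
    have hf : f ≠ 0 := right_ne_zero_of_mul (ne_zero_of_mem he)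
    rw [Nat.mul_div_cancel_left _ hd, ghost, ghostSum, ghostSum, Finset.mul_sum]
    symm
    refine Finset.sum_of_injOn (fun k => d * k) ?_ ?_ ?_ ?_
    · intro a _ b _ h
      exact Nat.eq_of_mul_eq_mul_left hd h
    · intro k hk
      simp only [Finset.mem_coe, Nat.mem_divisors] at hk ⊢
      exact ⟨Nat.mul_dvd_mul_left d hk.1, mul_ne_zero hd.ne' hf⟩
    · intro k hk hk'
      refine hterm k hk fun hdk => hk' ?_
      obtain ⟨l, rfl⟩ := hdk
      refine ⟨l, ?_, rfl⟩
      simp only [Finset.mem_coe, Nat.mem_divisors]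
      exact ⟨Nat.dvd_of_mul_dvd_mul_left hd (Nat.dvd_of_mem_divisors hk), hf⟩
    · intro k _
      simp only [dvd_mul_right, if_true]
      rw [Nat.mul_div_cancel_left _ hd, Nat.mul_div_mul_left _ _ hd]
      push_cast
      ring
  · refine Finset.sum_eq_zero fun k hk => hterm k hk fun hdk => hde ?_
    exact hdk.trans (Nat.dvd_of_mem_divisors hk)

theorem map_frobenius (f : R →+* S) (m n : ℕ) (x : BigWitt n R) :
    map m f (frobenius m n x) = frobenius m n (map n f x) := by
  refine (mapFun_ofFun f _).trans ?_
  simp only [map_aeval_int, ← coeff_mapFun]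
  rfl

theorem map_verschiebung (f : R →+* S) (m n : ℕ) (x : BigWitt m R) :
    map n f (verschiebung m n x) = verschiebung m n (map m f x) := by
  refine (mapFun_ofFun f _).trans ?_
  simp only [apply_ite f, map_zero, ← coeff_mapFun]
  rfl

theorem ghost_map (f : R →+* S) (x : BigWitt m R) (e : ℕ) :
    (map m f x).ghost e = f (x.ghost e) := by
  refine Eq.trans ?_ (map_ghostSum f x.coeff e).symm
  simp only [← coeff_mapFun]
  rfl

end BigWitt

/-- The ideal of `W_m(R)[q]` generated by the elements `(q^e - 1) V_{m/e}(x)`, for `e ∣ m` and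
`x ∈ W_e(R)`, and `[e/d]_{q^d} V_{m/e}(x) - V_{m/d}(F_{e/d}(x))`, for `d ∣ e ∣ m` and `x ∈ W_e(R)`.
The polynomial variable is `q`. -/
noncomputable def qWittIdeal (m : ℕ) (R : Type*) [CommRing R] : Ideal (BigWitt m R)[X] :=
  Ideal.span
    ({f | ∃ e, e ∣ m ∧ ∃ x : BigWitt e R, f = (X ^ e - 1) * C (BigWitt.verschiebung e m x)} ∪
     {f | ∃ d e, d ∣ e ∧ e ∣ m ∧ ∃ x : BigWitt e R,
        f = (∑ i ∈ Finset.range (e / d), (X ^ d) ^ i) * C (BigWitt.verschiebung e m x) -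
          C (BigWitt.verschiebung d m (BigWitt.frobenius d e x))})

/-- The `m`-truncated big `q`-Witt vectors of `R`. -/
abbrev QWitt (m : ℕ) (R : Type*) [CommRing R] : Type _ := (BigWitt m R)[X] ⧸ qWittIdeal m R

namespace QWitt

variable {R S : Type*} [CommRing R] [CommRing S]

theorem qWittIdeal_le_comap (m : ℕ) (f : R →+* S) :
    qWittIdeal m R ≤ (qWittIdeal m S).comap (mapRingHom (BigWitt.map m f)) := by
  rw [qWittIdeal, Ideal.span_le]
  rintro _ (⟨e, he, x, rfl⟩ | ⟨d, e, hde, he, x, rfl⟩)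
  · refine Ideal.subset_span (Or.inl ⟨e, he, BigWitt.map e f x, ?_⟩)
    simp [BigWitt.map_verschiebung]
  · refine Ideal.subset_span (Or.inr ⟨d, e, hde, he, BigWitt.map e f x, ?_⟩)
    simp [BigWitt.map_verschiebung, BigWitt.map_frobenius, Polynomial.map_sum]

/-- Functoriality of big `q`-Witt vectors. -/
noncomputable def map (m : ℕ) (f : R →+* S) : QWitt m R →+* QWitt m S :=
  Ideal.quotientMap (qWittIdeal m S) (mapRingHom (BigWitt.map m f)) (qWittIdeal_le_comap m f)

theorem div_mem_divisors {m e : ℕ} (he : e ∈ m.divisors) : m / e ∈ m.divisors :=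
  Nat.mem_divisors.mpr
    ⟨Nat.div_dvd_of_dvd (Nat.dvd_of_mem_divisors he), (Nat.mem_divisors.mp he).2⟩

/-- The `ℤ[q]`-algebra map `W_m(R)[q] → R[q]/Φ_e(q)` given by the `(m/e)`-th ghost coordinate on
`W_m(R)`. -/
noncomputable def preGhost (R : Type*) [CommRing R] {m e : ℕ} (he : e ∈ m.divisors) :
    (BigWitt m R)[X] →+* AdjoinRoot (cyclotomic e R) :=
  (AdjoinRoot.mk (cyclotomic e R)).comp
    (mapRingHom (BigWitt.ghostHom R (div_mem_divisors he)))

theorem preGhost_X {m e : ℕ} (he : e ∈ m.divisors) :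
    preGhost R he X = AdjoinRoot.root (cyclotomic e R) := by
  simp [preGhost]

theorem preGhost_C {m e : ℕ} (he : e ∈ m.divisors) (x : BigWitt m R) :
    preGhost R he (C x) = AdjoinRoot.of (cyclotomic e R) (x.ghost (m / e)) := by
  simp [preGhost, BigWitt.ghostHom]

theorem root_pow_eq_one {e n : ℕ} (h : e ∣ n) :
    AdjoinRoot.root (cyclotomic e R) ^ n = 1 := by
  have h1 : cyclotomic e R ∣ X ^ n - 1 :=
    (cyclotomic.dvd_X_pow_sub_one e R).trans (by
      obtain ⟨k, rfl⟩ := h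
      rw [pow_mul]
      simpa using sub_dvd_pow_sub_pow (X ^ e : R[X]) 1 k)
  have h2 := AdjoinRoot.mk_eq_zero.mpr h1
  rw [map_sub, map_pow, AdjoinRoot.mk_X, map_one] at h2
  exact sub_eq_zero.mp h2

theorem geom_sum_root_eq_zero {c d k : ℕ} (hc : c ∣ d * k) (hcd : ¬ c ∣ d) (hdk : d * k ≠ 0) :
    ∑ i ∈ Finset.range k, (AdjoinRoot.root (cyclotomic c R) ^ d) ^ i = 0 := by
  have hdvd : cyclotomic c ℤ ∣ ∑ i ∈ Finset.range k, (X ^ d) ^ i := by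
    have hprod : (cyclotomic c ℤ) ∣ (∑ i ∈ Finset.range k, (X ^ d) ^ i) * (X ^ d - 1) := by
      rw [geom_sum_mul, ← pow_mul]
      rw [← prod_cyclotomic_eq_X_pow_sub_one (Nat.pos_of_ne_zero hdk) ℤ]
      exact Finset.dvd_prod_of_mem _ (Nat.mem_divisors.mpr ⟨hc, hdk⟩)
    have hc0 : 0 < c := Nat.pos_of_dvd_of_pos hc (Nat.pos_of_ne_zero hdk)
    have hd0 : 0 < d := Nat.pos_of_ne_zero (left_ne_zero_of_mul hdk)
    have hirr := (cyclotomic.irreducible hc0).prime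
    refine (hirr.dvd_or_dvd hprod).resolve_right fun h => hcd ?_
    rw [← prod_cyclotomic_eq_X_pow_sub_one hd0 ℤ] at h
    obtain ⟨b, hb, hcb⟩ := (hirr.dvd_finsetProd_iff _).mp h
    have hb0 := Nat.pos_of_mem_divisors hb
    have := eq_of_monic_of_associated (cyclotomic.monic c ℤ) (cyclotomic.monic b ℤ)
      ((cyclotomic.irreducible hc0).associated_of_dvd (cyclotomic.irreducible hb0) hcb)
    rw [cyclotomic_injective this]
    exact Nat.dvd_of_mem_divisors hb
  have h1 := Polynomial.map_dvd (Int.castRingHom R) hdvd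
  rw [map_cyclotomic, Polynomial.map_sum] at h1
  have h2 := AdjoinRoot.mk_eq_zero.mpr h1
  simpa using h2

theorem div_dvd_div_iff_of_dvd {m c e : ℕ} (hm : m ≠ 0) (hc : c ∣ m) (he : e ∣ m) :
    m / e ∣ m / c ↔ c ∣ e := by
  obtain ⟨a, rfl⟩ := he
  have he0 : 0 < e := Nat.pos_of_ne_zero (left_ne_zero_of_mul hm)
  have ha0 : 0 < a := Nat.pos_of_ne_zero (right_ne_zero_of_mul hm)
  have hc0 : 0 < c := Nat.pos_of_dvd_of_pos hc (Nat.pos_of_ne_zero hm)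
  rw [Nat.mul_div_cancel_left _ he0, Nat.dvd_div_iff_mul_dvd hc,
    Nat.mul_dvd_mul_iff_right ha0]

theorem ghost_verschiebung_div {m c e : ℕ} (hc : c ∈ m.divisors) (he : e ∣ m)
    (x : BigWitt e R) : (BigWitt.verschiebung e m x).ghost (m / c) =
      if c ∣ e then ((m / e : ℕ) : R) * x.ghost (e / c) else 0 := by
  have hm := (Nat.mem_divisors.mp hc).2
  have hcm := Nat.dvd_of_mem_divisors hc
  rw [BigWitt.ghost_verschiebung he x (div_mem_divisors hc)]
  simp only [div_dvd_div_iff_of_dvd hm hcm he]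
  split_ifs with hce
  · obtain ⟨a, rfl⟩ := he
    obtain ⟨b, rfl⟩ := hce
    have h0 := Nat.pos_of_ne_zero hm
    have ha : 0 < a := Nat.pos_of_mul_pos_left h0
    have hcb : 0 < c * b := Nat.pos_of_mul_pos_right h0
    have hc0 : 0 < c := Nat.pos_of_mul_pos_right hcb
    rw [Nat.mul_div_cancel_left _ hcb, mul_assoc, Nat.mul_div_cancel_left _ hc0,
      Nat.mul_div_cancel_left _ hc0, Nat.mul_div_cancel _ ha]
  · rfl

theorem preGhost_eq_zero {m e : ℕ} (he : e ∈ m.divisors) (f : (BigWitt m R)[X])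
    (hf : f ∈ qWittIdeal m R) : preGhost R he f = 0 := by
  suffices h : qWittIdeal m R ≤ RingHom.ker (preGhost R he) from h hf
  have hm := (Nat.mem_divisors.mp he).2
  rw [qWittIdeal, Ideal.span_le]
  rintro _ (⟨b, hb, x, rfl⟩ | ⟨d, b, hdb, hb, x, rfl⟩)
  · simp only [SetLike.mem_coe, RingHom.mem_ker, map_mul, map_sub, map_pow, map_one, preGhost_X,
      preGhost_C, ghost_verschiebung_div he hb]
    split_ifs with h
    · rw [root_pow_eq_one h, sub_self, zero_mul]
    · rw [map_zero, mul_zero]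
  · simp only [SetLike.mem_coe, RingHom.mem_ker, map_mul, map_sub, map_pow, map_sum, preGhost_X,
      preGhost_C, ghost_verschiebung_div he hb, ghost_verschiebung_div he (hdb.trans hb)]
    have hb0 := ne_zero_of_dvd_ne_zero hm hb
    obtain ⟨k, rfl⟩ := hdb
    have hd0 : 0 < d := Nat.pos_of_ne_zero (left_ne_zero_of_mul hb0)
    have hk0 : 0 < k := Nat.pos_of_ne_zero (right_ne_zero_of_mul hb0)
    rw [Nat.mul_div_cancel_left _ hd0]
    by_cases h : e ∣ d
    · rw [if_pos h, if_pos (h.mul_right k), root_pow_eq_one h,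
        BigWitt.ghost_frobenius (Dvd.intro k rfl) hb0 x
          (div_mem_divisors (Nat.mem_divisors.mpr ⟨h, hd0.ne'⟩))]
      obtain ⟨a, rfl⟩ := hb
      have he0 : 0 < e := Nat.pos_of_dvd_of_pos h hd0
      have hdiv : d * k / e = k * (d / e) := by rw [mul_comm d k, Nat.mul_div_assoc k h]
      rw [Nat.mul_div_cancel_left _ (Nat.pos_of_ne_zero hb0), mul_assoc d k a,
        Nat.mul_div_cancel_left _ hd0, Nat.mul_div_cancel_left _ hd0, hdiv]
      simp only [one_pow, Finset.sum_const, Finset.card_range, map_mul, map_natCast,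
        nsmul_eq_mul, Nat.cast_mul]
      ring
    · rw [if_neg h, map_zero, sub_zero]
      split_ifs with h'
      · rw [geom_sum_root_eq_zero h' h hb0, zero_mul]
      · rw [map_zero, mul_zero]

/-- The `e`-th `q`-ghost coordinate `q-W_m(R) → R[q]/Φ_e(q)`, for `e ∣ m`. -/
noncomputable def ghostCoord (R : Type*) [CommRing R] {m e : ℕ} (he : e ∈ m.divisors) :
    QWitt m R →+* AdjoinRoot (cyclotomic e R) :=
  Ideal.Quotient.lift (qWittIdeal m R) (preGhost R he) (preGhost_eq_zero he)

/-- The `q`-ghost map `q-W_m(R) → ∏_{e ∣ m} R[q]/Φ_e(q)`. -/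
noncomputable def ghost (m : ℕ) (R : Type*) [CommRing R] :
    QWitt m R →+* ∀ e : m.divisors, AdjoinRoot (cyclotomic (e : ℕ) R) :=
  RingHom.pi fun e => ghostCoord R e.2

theorem cyclotomic_subst (R : Type*) [CommRing R] {g e : ℕ} (hge : g ∣ e) (he : 0 < e) :
    (cyclotomic g R).eval₂ (AdjoinRoot.of (cyclotomic e R))
      (AdjoinRoot.root (cyclotomic e R) ^ (e / g)) = 0 := by
  have hg : 0 < g := Nat.pos_of_dvd_of_pos hge he
  have hdvd : cyclotomic e ℤ ∣ expand ℤ (e / g) (cyclotomic g ℤ) := by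
    have hζ := Complex.isPrimitiveRoot_exp e he.ne'
    rw [cyclotomic_eq_minpoly hζ he]
    refine minpoly.isIntegrallyClosed_dvd (hζ.isIntegral he) ?_
    have hp := hζ.pow he (Nat.div_mul_cancel hge).symm
    rw [expand_aeval, ← eval_map_algebraMap, algebraMap_int_eq, map_cyclotomic]
    have := NeZero.of_pos hg
    exact (isRoot_cyclotomic_iff.mpr hp)
  have h1 := Polynomial.map_dvd (Int.castRingHom R) hdvd
  rw [map_cyclotomic, map_expand, map_cyclotomic] at h1
  have h2 := AdjoinRoot.mk_eq_zero.mpr h1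
  rw [← AdjoinRoot.aeval_eq, expand_aeval, aeval_def] at h2
  exact h2

/-- The map `R[q]/Φ_g(q) → R[q]/Φ_e(q)`, `c(q) ↦ c(q^(e/g))`, for `g ∣ e`. -/
noncomputable def subst (R : Type*) [CommRing R] {g e : ℕ} (hge : g ∣ e) (he : 0 < e) :
    AdjoinRoot (cyclotomic g R) →+* AdjoinRoot (cyclotomic e R) :=
  AdjoinRoot.lift (AdjoinRoot.of (cyclotomic e R)) (AdjoinRoot.root (cyclotomic e R) ^ (e / g))
    (cyclotomic_subst R hge he)

theorem gcd_mem_divisors {m m' : ℕ} (h : m ∣ m') (e : m'.divisors) :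
    Nat.gcd e m ∈ m.divisors :=
  Nat.mem_divisors.mpr ⟨Nat.gcd_dvd_right _ _,
    ne_zero_of_dvd_ne_zero (Nat.mem_divisors.mp e.2).2 h⟩

/-- The formula for the cyclotomic norm in `q`-ghost coordinates:
`(c_e(q))_{e ∣ m} ↦ (c_{(e,m)}(q^{e/(e,m)})^{m'/[e,m]})_{e ∣ m'}`. -/
noncomputable def ghostNorm (R : Type*) [CommRing R] {m m' : ℕ} (h : m ∣ m')
    (c : ∀ e : m.divisors, AdjoinRoot (cyclotomic (e : ℕ) R)) (e : m'.divisors) :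
    AdjoinRoot (cyclotomic (e : ℕ) R) :=
  subst R (Nat.gcd_dvd_left (e : ℕ) m) (Nat.pos_of_mem_divisors e.2)
    (c ⟨Nat.gcd e m, gcd_mem_divisors h e⟩) ^ (m' / Nat.lcm e m)

end QWitt

/-! Everything rests on one fact: over a domain of characteristic zero the `q`-ghost map is
injective (`QWitt.ghost_injective`). To see this, filter `W_m(R)[q]` by the defining ideal together
with the elements `q^i V_{m/d}([r])` for `d < n`. Modulo lower terms, `V_{m/e}([r])` is additive in
`r`, and the two families of relations kill `q^e - 1` and every `[e/d]_{q^d}` with `d < e`. In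
`ℤ[q]` these generate an ideal containing `Φ_e`, so the `e`-th graded piece is a quotient of
`R[q]/Φ_e`. The `e`-th ghost coordinate restricted to it is induced by multiplication by `m/e` on
`R[q]/Φ_e`, which is injective. A vector with vanishing ghost coordinates therefore descends through
the filtration into the ideal.

For existence (`QWitt.hasNorm`), the formula is transitive in `m ∣ m'`, which leaves `m' = pm` with
`p` prime. The vectors whose norm exists in ghost coordinates are closed under products, and under
sums because the binomial cross terms of `(a + b)^p` are divisible by `p` and can be realised by a
transfer `V_p`. It remains to exhibit norms of `q` and of `V_k([r])`.

A general `R` is a quotient of a polynomial ring over `ℤ`, where the norm is determined by its ghost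
coordinates. The norm descends because two lifts of the same vector are specialisations, along maps
that agree in `R`, of a single vector over a larger polynomial ring (`QWitt.map_preNorm_congr`).
Uniqueness uses the same cover: naturality reduces it to the polynomial ring, where injectivity
applies. -/

namespace BigWitt

/-! ### Decomposition of big Witt vectors into the elements `V_d([r])`. -/

variable {m : ℕ} {R S : Type*} [CommRing R] [CommRing S]

/-- The big Witt vector `V_d([r])`, whose only possibly nonzero Witt coordinate is `r`, in
degree `d`. -/
def single (m d : ℕ) (r : R) : BigWitt m R := ofFun m fun e => if e = d then r else 0

theorem map_cover_surjective : Function.Surjective (map m (cover R)) := mapFun_cover_surjective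

theorem coeff_map (f : R →+* S) (x : BigWitt m R) (e : ℕ) :
    (map m f x).coeff e = f (x.coeff e) := coeff_mapFun f x e

theorem map_single (f : R →+* S) (d : ℕ) (r : R) : map m f (single m d r) = single m d (f r) := by
  refine (mapFun_ofFun f _).trans ?_
  simp only [apply_ite f, map_zero]
  rfl

theorem ghost_single (d : ℕ) (r : R) {e : ℕ} (he : e ∈ m.divisors) :
    (single m d r).ghost e = if d ∣ e then (d : R) * r ^ (e / d) else 0 := by
  refine (ghost_ofFun _ he).trans ?_
  have he0 := ne_zero_of_mem he
  rw [ghostSum]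
  split_ifs with h
  · rw [Finset.sum_eq_single d, if_pos rfl]
    · intro b hb hbd
      rw [if_neg hbd, zero_pow, mul_zero]
      exact (Nat.div_pos (Nat.divisor_le hb) (Nat.pos_of_mem_divisors hb)).ne'
    · exact fun hd => absurd (Nat.mem_divisors.mpr ⟨h, he0⟩) hd
  · refine Finset.sum_eq_zero fun b hb => ?_
    rw [if_neg, zero_pow, mul_zero]
    · exact (Nat.div_pos (Nat.divisor_le hb) (Nat.pos_of_mem_divisors hb)).ne'
    · rintro rfl
      exact h (Nat.dvd_of_mem_divisors hb)

theorem single_zero (d : ℕ) : single m d (0 : R) = 0 := by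
  simp only [single, ite_self]
  rfl

theorem ghost_sum {ι : Type*} (s : Finset ι) (x : ι → BigWitt m R) {e : ℕ} (he : e ∈ m.divisors) :
    (∑ i ∈ s, x i).ghost e = ∑ i ∈ s, (x i).ghost e :=
  map_sum (ghostHom R he) x s

/-- Both sides are natural in `R`, so the identity may be checked over the polynomial ring `cover
R`, where ghost coordinates separate points; there it is the defining formula of the ghost map. The
later identities for `V` and `F` that are not read off Witt coordinates are lifted in the same way.
-/
theorem eq_sum_single (x : BigWitt m R) : x = ∑ d ∈ m.divisors, single m d (x.coeff d) := by
  obtain ⟨x, rfl⟩ := map_cover_surjective x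
  simp only [coeff_map, ← map_single, ← map_sum]
  congr 1
  refine ext_ghost fun e he => ?_
  rw [ghost_sum _ _ he, Finset.sum_congr rfl fun d _ => ghost_single d _ he,
    ← Finset.sum_filter, ghost, ghostSum]
  refine Finset.sum_congr ?_ fun _ _ => rfl
  ext d
  have := Nat.mem_divisors.mp he
  simp only [Nat.mem_divisors, Finset.mem_filter]
  exact ⟨fun h => ⟨⟨h.1.trans this.1, this.2⟩, h.1⟩, fun h => ⟨h.2, ne_zero_of_mem he⟩⟩

/-- The Verschiebung as an additive homomorphism. -/
noncomputable def verschiebungHom (R : Type*) [CommRing R] {e m : ℕ} (he : e ∣ m) :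
    BigWitt e R →+ BigWitt m R :=
  AddMonoidHom.mk' (verschiebung e m) fun x y => by
    obtain ⟨x, rfl⟩ := map_cover_surjective x
    obtain ⟨y, rfl⟩ := map_cover_surjective y
    simp only [← map_add, ← map_verschiebung]
    congr 1
    refine ext_ghost fun f hf => ?_
    rw [ghost_add _ _ hf]
    simp only [ghost_verschiebung he _ hf]
    split_ifs with h
    · rw [ghost_add, mul_add]
      have hm := Nat.mem_divisors.mp hf
      refine Nat.mem_divisors.mpr ⟨?_, ne_zero_of_dvd_ne_zero hm.2 he⟩
      rw [Nat.div_dvd_iff_dvd_mul h (Nat.pos_of_dvd_of_pos h (Nat.pos_of_mem_divisors hf)),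
        Nat.div_mul_cancel he]
      exact hm.1
    · rw [add_zero]

theorem verschiebung_single {e k : ℕ} (he : e ∣ m) (r : R) :
    verschiebung e m (single e k r) = single m (m / e * k) r := by
  refine ext_coeff fun f hf => ?_
  have hm := Nat.mem_divisors.mp hf
  obtain ⟨a, rfl⟩ := he
  have he0 : 0 < e := Nat.pos_of_ne_zero (left_ne_zero_of_mul hm.2)
  have ha0 : 0 < a := Nat.pos_of_ne_zero (right_ne_zero_of_mul hm.2)
  simp only [verschiebung, single, coeff_ofFun _ hf, Nat.mul_div_cancel_left _ he0]
  by_cases h : a ∣ f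
  · obtain ⟨l, rfl⟩ := h
    have hl : l ∈ e.divisors := by
      refine Nat.mem_divisors.mpr ⟨?_, he0.ne'⟩
      rw [mul_comm e a] at hm
      exact Nat.dvd_of_mul_dvd_mul_left ha0 hm.1
    rw [if_pos (dvd_mul_right a l), Nat.mul_div_cancel_left _ ha0, coeff_ofFun _ hl]
    simp [ha0.ne']
  · rw [if_neg h, if_neg]
    rintro rfl
    exact h (dvd_mul_right a k)

theorem frobenius_single_one {d e : ℕ} (hde : d ∣ e) (he : e ≠ 0) (r : R) :
    frobenius d e (single e 1 r) = single d 1 (r ^ (e / d)) := by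
  obtain ⟨r, rfl⟩ : ∃ s, cover R s = r := ⟨MvPolynomial.X r, by simp [cover]⟩
  simp only [← map_pow, ← map_single, ← map_frobenius]
  congr 1
  refine ext_ghost fun f hf => ?_
  rw [ghost_frobenius hde he _ hf, ghost_single _ _ hf, ghost_single]
  · simp [pow_mul]
  · obtain ⟨k, rfl⟩ := hde
    have := Nat.mem_divisors.mp hf
    rw [Nat.mul_div_cancel_left _ (Nat.pos_of_ne_zero this.2), mul_comm d k]
    exact Nat.mem_divisors.mpr ⟨Nat.mul_dvd_mul_left k this.1, by rwa [mul_comm]⟩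

/-- The element is `V_{m/e}` of `y = [r+s] - [r] - [s]` in `W_e(R)`, and `y` has first Witt
coordinate zero. So `y` is a sum of terms `V_k([y_k])` with `1 < k ∣ e`, and `V_{m/e}` moves each to
degree `(m/e) * k = m/(e/k)`, with `e/k < e`. -/
theorem single_add_sub_mem {e : ℕ} (he : e ∣ m) (hm : m ≠ 0) (r s : R) :
    single m (m / e) (r + s) - single m (m / e) r - single m (m / e) s ∈
      AddSubgroup.closure {x | ∃ d t, d ∣ m ∧ d < e ∧ x = single m (m / d) (t : R)} := by
  have he0 : e ≠ 0 := ne_zero_of_dvd_ne_zero hm he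
  set y : BigWitt e R := single e 1 (r + s) - single e 1 r - single e 1 s with hy
  have h1 : (1 : ℕ) ∈ e.divisors := Nat.one_mem_divisors.mpr he0
  have hy1 : y.coeff 1 = 0 := by
    have : y.ghost 1 = 0 := by
      change ghostHom R h1 y = 0
      rw [hy, map_sub, map_sub]
      change (single e 1 (r + s)).ghost 1 - (single e 1 r).ghost 1 - (single e 1 s).ghost 1 = 0
      simp [ghost_single _ _ h1]
    simpa [ghost, ghostSum] using this
  have hV : single m (m / e) (r + s) - single m (m / e) r - single m (m / e) s =
      verschiebungHom R he y := by
    rw [hy, map_sub, map_sub]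
    change _ = verschiebung e m _ - verschiebung e m _ - verschiebung e m _
    simp only [verschiebung_single he, mul_one]
  rw [hV, eq_sum_single y, map_sum]
  refine AddSubgroup.sum_mem _ fun k hk => ?_
  change verschiebung e m _ ∈ _
  rw [verschiebung_single he]
  by_cases hk1 : k = 1
  · rw [hk1, hy1, single_zero]
    exact AddSubgroup.zero_mem _
  · refine AddSubgroup.subset_closure ⟨e / k, y.coeff k, ?_, ?_, ?_⟩
    · exact (Nat.div_dvd_of_dvd (Nat.dvd_of_mem_divisors hk)).trans he
    · have := Nat.pos_of_mem_divisors hk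
      exact Nat.div_lt_self (Nat.pos_of_ne_zero he0) (by omega)
    · obtain ⟨a, rfl⟩ := he
      obtain ⟨b, rfl⟩ := Nat.dvd_of_mem_divisors hk
      have hk0 := Nat.pos_of_mem_divisors hk
      have hb0 : 0 < b := Nat.pos_of_ne_zero (right_ne_zero_of_mul he0)
      rw [Nat.mul_div_cancel_left _ (Nat.pos_of_ne_zero he0), Nat.mul_div_cancel_left _ hk0,
        show k * b * a = b * (a * k) by ring, Nat.mul_div_cancel_left _ hb0]

end BigWitt

/-! ### Cyclotomic polynomials and ideals of `ℤ[q]`. -/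

section CyclotomicIdeal

/-- Euclid's algorithm on the lengths: modulo `[a]_x`, the sum `[b]_x` is a power of `x` times `[b
mod a]_x`, and `x` is a unit modulo `[a]_x`. -/
theorem isCoprime_geom_sum {A : Type*} [CommRing A] (x : A) {a b : ℕ} (h : Nat.Coprime a b) :
    IsCoprime (∑ i ∈ Finset.range a, x ^ i) (∑ i ∈ Finset.range b, x ^ i) := by
  induction a, b using Nat.gcd.induction with
  | H0 n =>
    rw [Nat.coprime_zero_left] at h
    simp [h, isCoprime_one_right]
  | H1 a b ha ih =>
    have h' : Nat.Coprime (b % a) a := by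
      rw [Nat.Coprime, ← h.gcd_eq_one, Nat.gcd_rec a b]
    have ih := ih h'
    have key : ∑ i ∈ Finset.range b, x ^ i = x ^ (a * (b / a)) * ∑ i ∈ Finset.range (b % a), x ^ i +
        (∑ i ∈ Finset.range a, x ^ i) * ∑ j ∈ Finset.range (b / a), (x ^ a) ^ j := by
      conv_lhs => rw [← Nat.div_add_mod b a, Finset.sum_range_add]
      rw [add_comm, Finset.mul_sum]
      congr 1
      · simp only [pow_add]
      · generalize b / a = k
        induction k with
        | zero => simp
        | succ k ihk =>
          rw [Nat.mul_succ, Finset.sum_range_add, ihk, Finset.sum_range_succ, mul_add]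
          simp only [pow_add, ← Finset.mul_sum, pow_mul]
          ring
    have hx : IsCoprime (∑ i ∈ Finset.range a, x ^ i) x := by
      obtain ⟨c, rfl⟩ := Nat.exists_eq_succ_of_ne_zero ha.ne'
      refine ⟨1, -∑ i ∈ Finset.range c, x ^ i, ?_⟩
      rw [geom_sum_succ]
      ring
    rw [key]
    exact (IsCoprime.mul_right hx.pow_right ih.symm).add_mul_left_right _

/-- With `d = (f, g)`, the two polynomials divide `[f/d]_{q^d}` and `[g/d]_{q^d}`, which are coprime
already over `ℤ` since `f/d` and `g/d` are coprime. -/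
theorem isCoprime_cyclotomic {f g : ℕ} (hf : 0 < f) (hg : 0 < g) (hfg : ¬ f ∣ g) (hgf : ¬ g ∣ f) :
    IsCoprime (cyclotomic f ℤ) (cyclotomic g ℤ) := by
  have key : ∀ {a b : ℕ}, 0 < a → 0 < b → ¬ a ∣ b →
      cyclotomic a ℤ ∣ ∑ i ∈ Finset.range (a / a.gcd b), (X ^ a.gcd b) ^ i := by
    intro a b ha hb hab
    have hg0 : 0 < a.gcd b := Nat.gcd_pos_of_pos_left _ ha
    have hne : (X ^ a.gcd b - 1 : ℤ[X]) ≠ 0 := X_pow_sub_C_ne_zero hg0 1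
    refine (mul_dvd_mul_iff_right hne).mp ?_
    rw [geom_sum_mul, ← pow_mul, Nat.mul_div_cancel' (Nat.gcd_dvd_left a b),
      ← prod_cyclotomic_eq_X_pow_sub_one ha, ← prod_cyclotomic_eq_X_pow_sub_one hg0,
      ← Finset.prod_insert (f := fun i => cyclotomic i ℤ) (a := a)]
    · refine Finset.prod_dvd_prod_of_subset _ _ _ (Finset.insert_subset ?_ ?_)
      · exact Nat.mem_divisors_self a ha.ne'
      · exact Nat.divisors_subset_of_dvd ha.ne' (Nat.gcd_dvd_left a b)
    · intro h
      exact hab ((Nat.dvd_of_mem_divisors h).trans (Nat.gcd_dvd_right a b))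
  refine IsCoprime.of_isCoprime_of_dvd_left (IsCoprime.of_isCoprime_of_dvd_right
    (isCoprime_geom_sum _ ?_) (Nat.gcd_comm g f ▸ key hg hf hgf)) (key hf hg hfg)
  exact Nat.coprime_div_gcd_div_gcd (Nat.gcd_pos_of_pos_left _ hf)

theorem prod_cyclotomic_filter {e d : ℕ} (he : 0 < e) (hd : d ∣ e) :
    ∏ f ∈ e.divisors with ¬ f ∣ d, cyclotomic f ℤ = ∑ i ∈ Finset.range (e / d), (X ^ d) ^ i := by
  have hd0 : 0 < d := Nat.pos_of_dvd_of_pos hd he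
  have hne : (X ^ d - 1 : ℤ[X]) ≠ 0 := X_pow_sub_C_ne_zero hd0 1
  refine mul_right_cancel₀ hne ?_
  rw [geom_sum_mul, ← pow_mul, Nat.mul_div_cancel' hd, ← prod_cyclotomic_eq_X_pow_sub_one he,
    ← prod_cyclotomic_eq_X_pow_sub_one hd0, mul_comm]
  rw [← Finset.prod_filter_mul_prod_filter_not e.divisors (fun f => f ∣ d)]
  congr 1
  refine Finset.prod_congr ?_ fun _ _ => rfl
  ext f
  simp only [Nat.mem_divisors, Finset.mem_filter]
  exact ⟨fun h => ⟨⟨h.1.trans hd, he.ne'⟩, h.1⟩, fun h => ⟨h.2, Nat.ne_of_gt hd0⟩⟩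

/-- An ideal of `ℤ[q]` that contains `q ^ e - 1` and all quotients `(q ^ e - 1) / (q ^ d - 1)` for
proper divisors `d` of `e` contains the cyclotomic polynomial `Φ_e`. -/
theorem cyclotomic_mem_of_geom_sum_mem {e : ℕ} (he : 0 < e) (I : Ideal ℤ[X])
    (h0 : X ^ e - 1 ∈ I)
    (h : ∀ d, d ∣ e → d < e → ∑ i ∈ Finset.range (e / d), (X ^ d) ^ i ∈ I) :
    cyclotomic e ℤ ∈ I := by
  -- The primes dividing `e` are used one at a time. The empty set gives `q^e - 1`; for all primes
  -- only `f = e` survives, since every proper divisor of `e` divides some `e / p`.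
  have key : ∀ T : Finset ℕ, T ⊆ e.primeFactors →
      ∏ f ∈ e.divisors with ∀ p ∈ T, ¬ f ∣ e / p, cyclotomic f ℤ ∈ I := by
    intro T
    induction T using Finset.induction_on with
    | empty =>
      intro _
      simpa [prod_cyclotomic_eq_X_pow_sub_one he] using h0
    | insert l T hl ih =>
      intro hT
      have hlp : l.Prime := Nat.prime_of_mem_primeFactors (hT (Finset.mem_insert_self l T))
      have hle : l ∣ e := Nat.dvd_of_mem_primeFactors (hT (Finset.mem_insert_self l T))
      have hA := ih fun p hp => hT (Finset.mem_insert_of_mem hp)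
      have hB := h (e / l) (Nat.div_dvd_of_dvd hle) (Nat.div_lt_self he hlp.one_lt)
      rw [← prod_cyclotomic_filter he (Nat.div_dvd_of_dvd hle)] at hB
      rw [← Finset.prod_filter_mul_prod_filter_not _ (fun f => ¬ f ∣ e / l), Finset.filter_filter,
        Finset.filter_filter] at hA
      rw [← Finset.prod_filter_mul_prod_filter_not _ (fun f => ∀ p ∈ T, ¬ f ∣ e / p),
        Finset.filter_filter, Finset.filter_filter] at hB
      have e1 : (e.divisors.filter fun f => (∀ p ∈ T, ¬ f ∣ e / p) ∧ ¬ f ∣ e / l) =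
          e.divisors.filter fun f => ∀ p ∈ insert l T, ¬ f ∣ e / p := by
        refine Finset.filter_congr fun f _ => ?_
        rw [Finset.forall_mem_insert, and_comm]
      have e2 : (e.divisors.filter fun f => ¬ f ∣ e / l ∧ ∀ p ∈ T, ¬ f ∣ e / p) =
          e.divisors.filter fun f => ∀ p ∈ insert l T, ¬ f ∣ e / p := by
        refine Finset.filter_congr fun f _ => ?_
        rw [Finset.forall_mem_insert]
      rw [e1] at hA
      rw [e2] at hB
      -- The products in `hA` and `hB` share the factor wanted for `insert l T`, so it is enough
      -- that the cofactors are coprime. If `f ∣ g` then `f` divides some `e / p` with `p ∈ T`, and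
      -- if `g ∣ f` then `g ∣ e / l`; both are excluded.
      have hco : IsCoprime
          (∏ f ∈ e.divisors with (∀ p ∈ T, ¬ f ∣ e / p) ∧ ¬ ¬ f ∣ e / l, cyclotomic f ℤ)
          (∏ f ∈ e.divisors with ¬ f ∣ e / l ∧ ¬ ∀ p ∈ T, ¬ f ∣ e / p, cyclotomic f ℤ) := by
        refine IsCoprime.prod_left fun f hf => IsCoprime.prod_right fun g hg => ?_
        simp only [Finset.mem_filter, not_not, not_forall] at hf hg
        obtain ⟨p, hp, hgp⟩ := hg.2.2
        exact isCoprime_cyclotomic (Nat.pos_of_mem_divisors hf.1) (Nat.pos_of_mem_divisors hg.1)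
          (fun hfg => hf.2.1 p hp (hfg.trans hgp)) (fun hgf => hg.2.1 (hgf.trans hf.2.2))
      obtain ⟨u, v, huv⟩ := hco
      have := I.add_mem (I.mul_mem_left u hA) (I.mul_mem_left v hB)
      convert this using 1
      rw [mul_left_comm u, mul_left_comm v, ← mul_add, huv, mul_one]
  have := key _ subset_rfl
  convert this
  rw [show (e.divisors.filter fun f => ∀ p ∈ e.primeFactors, ¬ f ∣ e / p) = {e} from ?_,
    Finset.prod_singleton]
  ext f
  simp only [Finset.mem_filter, Nat.mem_divisors, Finset.mem_singleton, Nat.mem_primeFactors]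
  constructor
  · rintro ⟨⟨⟨k, rfl⟩, -⟩, hf⟩
    by_contra hne
    have hk : k ≠ 1 := by rintro rfl; simp at hne
    obtain ⟨p, hp, l, rfl⟩ := Nat.exists_prime_and_dvd hk
    refine hf p ⟨hp, (Dvd.intro l rfl).mul_left f, he.ne'⟩ ?_
    rw [show f * (p * l) = p * (f * l) by ring, Nat.mul_div_cancel_left _ hp.pos]
    exact dvd_mul_right f l
  · rintro rfl
    refine ⟨⟨dvd_rfl, he.ne'⟩, fun p hp hdvd => ?_⟩
    have h1 := Nat.div_lt_self he hp.1.one_lt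
    exact absurd (Nat.le_of_dvd (Nat.div_pos (Nat.le_of_dvd he hp.2.1) hp.1.pos) hdvd) h1.not_ge

end CyclotomicIdeal

/-! ### Injectivity of the `q`-ghost map in characteristic zero. -/

namespace QWitt

section Injectivity

variable {R : Type*} [CommRing R]

/-- The additive subgroup of `W_m(R)[q]` generated by the ideal defining the `q`-Witt vectors and
the elements `q^i V_{m/d}([r])` for divisors `d < n` of `m`. -/
noncomputable def vFil (R : Type*) [CommRing R] (m n : ℕ) : AddSubgroup (BigWitt m R)[X] :=
  (qWittIdeal m R).toAddSubgroup ⊔ AddSubgroup.closure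
    {F | ∃ d i r, d ∣ m ∧ d < n ∧ F = X ^ i * C (BigWitt.single m (m / d) r)}

theorem mem_vFil_of_mem_ideal {m n : ℕ} {F : (BigWitt m R)[X]} (h : F ∈ qWittIdeal m R) :
    F ∈ vFil R m n :=
  AddSubgroup.mem_sup_left h

theorem X_pow_mul_single_mem_vFil {m n d : ℕ} (hd : d ∣ m) (hdn : d < n) (i : ℕ) (r : R) :
    X ^ i * C (BigWitt.single m (m / d) r) ∈ vFil R m n :=
  AddSubgroup.mem_sup_right (AddSubgroup.subset_closure ⟨d, i, r, hd, hdn, rfl⟩)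

theorem vFil_induction {m n : ℕ} {p : (BigWitt m R)[X] → Prop}
    (hI : ∀ F ∈ qWittIdeal m R, p F)
    (hV : ∀ d i r, d ∣ m → d < n → p (X ^ i * C (BigWitt.single m (m / d) r)))
    (hadd : ∀ F G, p F → p G → p (F + G)) (hneg : ∀ F, p F → p (-F))
    {F : (BigWitt m R)[X]} (hF : F ∈ vFil R m n) : p F := by
  obtain ⟨A, hA, B, hB, rfl⟩ := AddSubgroup.mem_sup.mp hF
  refine hadd _ _ (hI _ hA) ?_
  clear hF
  induction hB using AddSubgroup.closure_induction with
  | mem x hx =>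
    obtain ⟨d, i, r, hd, hdn, rfl⟩ := hx
    exact hV d i r hd hdn
  | zero => exact hI _ (zero_mem _)
  | add x y _ _ hx hy => exact hadd _ _ hx hy
  | neg x _ hx => exact hneg _ hx

/-- The filtration steps are defined as additive subgroups only; stability under `ℤ[q]` is what lets
`Φ_e` act on the graded pieces. -/
theorem mul_mem_vFil {m n : ℕ} (u : ℤ[X]) {F : (BigWitt m R)[X]} (hF : F ∈ vFil R m n) :
    u.map (Int.castRingHom (BigWitt m R)) * F ∈ vFil R m n := by
  have hX : ∀ k, X ^ k * F ∈ vFil R m n := fun k => by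
    refine vFil_induction (p := fun F => X ^ k * F ∈ vFil R m n) ?_ ?_ ?_ ?_ hF
    · exact fun F hF => mem_vFil_of_mem_ideal (Ideal.mul_mem_left _ _ hF)
    · intro d i r hd hdn
      rw [← mul_assoc, ← pow_add]
      exact X_pow_mul_single_mem_vFil hd hdn _ r
    · intro F G hF hG
      rw [mul_add]
      exact add_mem hF hG
    · intro F hF
      rw [mul_neg]
      exact neg_mem hF
  induction u using Polynomial.induction_on' with
  | add p q hp hq =>
    rw [Polynomial.map_add, add_mul]
    exact add_mem hp hq
  | monomial k a =>
    rw [Polynomial.map_monomial, ← C_mul_X_pow_eq_monomial, mul_assoc]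
    have := AddSubgroup.zsmul_mem _ (hX k) a
    rw [zsmul_eq_mul] at this
    convert this
    simp

theorem mem_vFil_succ_self {m : ℕ} (hm : m ≠ 0) (F : (BigWitt m R)[X]) : F ∈ vFil R m (m + 1) := by
  induction F using Polynomial.induction_on' with
  | add p q hp hq => exact add_mem hp hq
  | monomial k a =>
    rw [BigWitt.eq_sum_single a, map_sum]
    refine AddSubgroup.sum_mem _ fun d hd => ?_
    rw [← C_mul_X_pow_eq_monomial, mul_comm]
    have hd' := div_mem_divisors hd
    have := X_pow_mul_single_mem_vFil (n := m + 1) (Nat.dvd_of_mem_divisors hd')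
      (Nat.lt_succ_of_le (Nat.divisor_le hd')) k (a.coeff d)
    rwa [Nat.div_div_self (Nat.dvd_of_mem_divisors hd) hm] at this

theorem mem_ideal_of_mem_vFil_one {m : ℕ} (hm : m ≠ 0) {F : (BigWitt m R)[X]}
    (hF : F ∈ vFil R m 1) : F ∈ qWittIdeal m R := by
  refine vFil_induction (fun F hF => hF) (fun d i r hd hdn => ?_) (fun _ _ => add_mem)
    (fun _ => neg_mem) hF
  obtain rfl : d = 0 := by omega
  exact absurd (Nat.eq_zero_of_zero_dvd hd) hm

theorem preGhost_single {m e d : ℕ} (he : e ∈ m.divisors) (hd : d ∣ m) (r : R) :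
    preGhost R he (C (BigWitt.single m (m / d) r)) =
      if e ∣ d then AdjoinRoot.of _ ((m / d : ℕ) * r ^ (d / e)) else 0 := by
  have hm := (Nat.mem_divisors.mp he).2
  rw [preGhost_C, BigWitt.ghost_single _ _ (div_mem_divisors he)]
  simp only [div_dvd_div_iff_of_dvd hm (Nat.dvd_of_mem_divisors he) hd]
  split_ifs with h
  · congr 3
    obtain ⟨a, rfl⟩ := h
    obtain ⟨b, rfl⟩ := hd
    have he0 := Nat.pos_of_mem_divisors he
    have hb : 0 < b := Nat.pos_of_ne_zero (right_ne_zero_of_mul hm)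
    rw [Nat.mul_div_cancel_left _ (Nat.pos_of_ne_zero (left_ne_zero_of_mul hm)), mul_assoc,
      Nat.mul_div_cancel_left _ he0, Nat.mul_div_cancel_left _ he0, Nat.mul_div_cancel _ hb]
  · exact map_zero _

theorem preGhost_eq_zero_of_mem_vFil {m e : ℕ} (he : e ∈ m.divisors) {F : (BigWitt m R)[X]}
    (hF : F ∈ vFil R m e) : preGhost R he F = 0 := by
  refine vFil_induction (preGhost_eq_zero he) (fun d i r hd hde => ?_) (fun F G hF hG => ?_)
    (fun F hF => ?_) hF
  · rw [map_mul, preGhost_single he hd, if_neg, mul_zero]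
    intro h
    have := Nat.le_of_dvd (Nat.pos_of_dvd_of_pos hd (Nat.pos_of_ne_zero
      (Nat.mem_divisors.mp he).2)) h
    omega
  · rw [map_add, hF, hG, add_zero]
  · rw [map_neg, hF, neg_zero]

/-- The `e`-th graded piece of the filtration `vFil` as a target of `R[q]`: the additive map
`∑ r_i q^i ↦ ∑ q^i V_{m/e}([r_i])`. -/
noncomputable def toGraded (R : Type*) [CommRing R] {m e : ℕ} (he : e ∣ m) (hm : m ≠ 0) :
    R[X] →+ (BigWitt m R)[X] ⧸ vFil R m e where
  toFun h := h.sum fun i r => QuotientAddGroup.mk (X ^ i * C (BigWitt.single m (m / e) r))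
  map_zero' := Polynomial.sum_zero_index _
  map_add' h h' := by
    refine Polynomial.sum_add_index h h' _ (fun i => ?_) fun i r s => ?_
    · rw [BigWitt.single_zero, C_0, mul_zero]
      rfl
    · rw [← QuotientAddGroup.mk_add, ← mul_add, ← C_add, eq_comm, QuotientAddGroup.eq,
        ← sub_eq_neg_add, ← mul_sub, ← C_sub, ← sub_sub]
      -- Additivity of `r ↦ V_{m/e}([r])` fails in `W_m(R)` itself, but the defect lies in lower
      -- filtration.
      have key := BigWitt.single_add_sub_mem he hm r s
      generalize BigWitt.single m (m / e) (r + s) - BigWitt.single m (m / e) r -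
        BigWitt.single m (m / e) s = w at key
      induction key using AddSubgroup.closure_induction with
      | mem x hx =>
        obtain ⟨d, t, hd, hde, rfl⟩ := hx
        exact X_pow_mul_single_mem_vFil hd hde i t
      | zero => simp
      | add x y _ _ hx hy =>
        rw [C_add, mul_add]
        exact add_mem hx hy
      | neg x _ hx =>
        rw [C_neg, mul_neg]
        exact neg_mem hx

theorem toGraded_monomial {m e : ℕ} (he : e ∣ m) (hm : m ≠ 0) (i : ℕ) (r : R) :
    toGraded R he hm (monomial i r) =
      QuotientAddGroup.mk (X ^ i * C (BigWitt.single m (m / e) r)) := by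
  refine Polynomial.sum_monomial_index (S := (BigWitt m R)[X] ⧸ vFil R m e) r
    (fun i r => QuotientAddGroup.mk (X ^ i * C (BigWitt.single m (m / e) r))) ?_
  rw [BigWitt.single_zero, C_0, mul_zero]
  rfl

theorem toGraded_mul_monomial {m e : ℕ} (he : e ∣ m) (hm : m ≠ 0) (u : ℤ[X]) (i : ℕ) (r : R) :
    toGraded R he hm (u.map (Int.castRingHom R) * monomial i r) = QuotientAddGroup.mk
      (u.map (Int.castRingHom (BigWitt m R)) * (X ^ i * C (BigWitt.single m (m / e) r))) := by
  induction u using Polynomial.induction_on' with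
  | add p q hp hq =>
    rw [Polynomial.map_add, add_mul, map_add, hp, hq, Polynomial.map_add, add_mul,
      QuotientAddGroup.mk_add]
  | monomial k a =>
    rw [Polynomial.map_monomial, Polynomial.map_monomial, monomial_mul_monomial, eq_intCast,
      ← zsmul_eq_mul, map_zsmul (monomial (k + i)), map_zsmul, toGraded_monomial,
      ← QuotientAddGroup.mk_zsmul]
    congr 1
    rw [← C_mul_X_pow_eq_monomial, zsmul_eq_mul, eq_intCast, pow_add, map_intCast]
    ring

/-- The defining relations of the `q`-Witt vectors enter here. The first kills `q^e - 1`. By the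
second, `[e/d]_{q^d} V_{m/e}([r])` is congruent to `V_{m/d}(F_{e/d}([r])) = V_{m/d}([r^{e/d}])`,
which is of lower filtration when `d < e`. Hence `Φ_e` acts as zero too. -/
theorem toGraded_cyclotomic_mul {m e : ℕ} (he : e ∣ m) (hm : m ≠ 0) (h : R[X]) :
    toGraded R he hm (cyclotomic e R * h) = 0 := by
  have he0 : 0 < e := Nat.pos_of_dvd_of_pos he (Nat.pos_of_ne_zero hm)
  induction h using Polynomial.induction_on' with
  | add p q hp hq => rw [mul_add, map_add, hp, hq, add_zero]
  | monomial i r =>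
    rw [← map_cyclotomic e (Int.castRingHom R), toGraded_mul_monomial,
      QuotientAddGroup.eq_zero_iff]
    -- The annihilator in `ℤ[q]` of the class of one monomial; the problem becomes `Φ_e ∈ J`.
    let J : Ideal ℤ[X] :=
      { carrier := {u | u.map (Int.castRingHom (BigWitt m R)) *
          (X ^ i * C (BigWitt.single m (m / e) r)) ∈ vFil R m e}
        zero_mem' := by simp
        add_mem' := fun {u v} hu hv => by
          simp only [Set.mem_ofPred_eq, Polynomial.map_add, add_mul] at hu hv ⊢
          exact add_mem hu hv
        smul_mem' := fun u v hv => by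
          simp only [Set.mem_ofPred_eq, smul_eq_mul, Polynomial.map_mul, mul_assoc] at hv ⊢
          exact mul_mem_vFil u hv }
    have hs : BigWitt.single m (m / e) r = BigWitt.verschiebung e m (BigWitt.single e 1 r) := by
      rw [BigWitt.verschiebung_single he, mul_one]
    refine cyclotomic_mem_of_geom_sum_mem he0 J ?_ fun d hd hde => ?_
    · refine mem_vFil_of_mem_ideal ?_
      rw [mul_left_comm]
      refine Ideal.mul_mem_left _ _ (Ideal.subset_span (Or.inl ⟨e, he, BigWitt.single e 1 r, ?_⟩))
      rw [hs]
      simp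
    · have h1 : (∑ k ∈ Finset.range (e / d), (X ^ d) ^ k) * C (BigWitt.verschiebung e m
          (BigWitt.single e 1 r)) - C (BigWitt.verschiebung d m (BigWitt.frobenius d e
          (BigWitt.single e 1 r))) ∈ qWittIdeal m R :=
        Ideal.subset_span (Or.inr ⟨d, e, hd, he, BigWitt.single e 1 r, rfl⟩)
      rw [BigWitt.frobenius_single_one hd he0.ne', BigWitt.verschiebung_single (hd.trans he),
        mul_one, ← hs] at h1
      have h2 := add_mem (mem_vFil_of_mem_ideal (n := e) (Ideal.mul_mem_left _ (X ^ i) h1))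
        (X_pow_mul_single_mem_vFil (hd.trans he) hde i (r ^ (e / d)))
      rw [mul_sub, sub_add_cancel, mul_left_comm] at h2
      change _ ∈ vFil R m e
      simpa [Polynomial.map_sum] using h2

theorem mk_mem_range_toGraded {m e : ℕ} (he : e ∣ m) (hm : m ≠ 0) {F : (BigWitt m R)[X]}
    (hF : F ∈ vFil R m (e + 1)) : ∃ h, toGraded R he hm h = QuotientAddGroup.mk F := by
  refine vFil_induction (p := fun F => ∃ h, toGraded R he hm h = QuotientAddGroup.mk F)
    (fun F hF => ⟨0, ?_⟩) (fun d i r hd hde => ?_) ?_ ?_ hF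
  · rw [map_zero, eq_comm, QuotientAddGroup.eq_zero_iff]
    exact mem_vFil_of_mem_ideal hF
  · rcases (Nat.lt_succ_iff_lt_or_eq).mp hde with h | rfl
    · refine ⟨0, ?_⟩
      rw [map_zero, eq_comm, QuotientAddGroup.eq_zero_iff]
      exact X_pow_mul_single_mem_vFil hd h i r
    · exact ⟨monomial i r, toGraded_monomial he hm i r⟩
  · rintro F G ⟨f, hf⟩ ⟨g, hg⟩
    exact ⟨f + g, by rw [map_add, hf, hg, QuotientAddGroup.mk_add]⟩
  · rintro F ⟨f, hf⟩
    exact ⟨-f, by rw [map_neg, hf, QuotientAddGroup.mk_neg]⟩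

/-- Remainders modulo a monic polynomial are `R`-linear, so `R[q]/f` inherits torsion-freeness from
`R[q]`. -/
theorem natCast_mul_adjoinRoot_eq_zero [IsDomain R] [CharZero R] {f : R[X]} (hf : f.Monic) {n : ℕ}
    (hn : n ≠ 0) {g : R[X]} (h : (n : AdjoinRoot f) * AdjoinRoot.mk f g = 0) :
    AdjoinRoot.mk f g = 0 := by
  rw [← map_natCast (AdjoinRoot.mk f), ← map_mul, AdjoinRoot.mk_eq_zero,
    ← modByMonic_eq_zero_iff_dvd hf, ← nsmul_eq_mul, ← Nat.cast_smul_eq_nsmul R,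
    smul_modByMonic, smul_eq_zero] at h
  rw [AdjoinRoot.mk_eq_zero, ← modByMonic_eq_zero_iff_dvd hf]
  exact h.resolve_left (Nat.cast_ne_zero.mpr hn)

/-- The composite of `toGraded` with the `e`-th ghost coordinate `γ` is `m/e` times the projection
`R[q] → R[q]/Φ_e`. If it vanishes at `h`, then `Φ_e ∣ h`, so `h` already represents zero in the
graded piece. -/
theorem mem_vFil_of_preGhost_eq_zero [IsDomain R] [CharZero R] {m e : ℕ} (he : e ∈ m.divisors)
    {F : (BigWitt m R)[X]} (hF : F ∈ vFil R m (e + 1)) (h0 : preGhost R he F = 0) :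
    F ∈ vFil R m e := by
  have hm := (Nat.mem_divisors.mp he).2
  have hem := Nat.dvd_of_mem_divisors he
  have he0 := Nat.pos_of_mem_divisors he
  obtain ⟨h, hh⟩ := mk_mem_range_toGraded hem hm hF
  let γ : (BigWitt m R)[X] ⧸ vFil R m e →+ AdjoinRoot (cyclotomic e R) :=
    QuotientAddGroup.lift _ (preGhost R he).toAddMonoidHom
      fun G hG => preGhost_eq_zero_of_mem_vFil he hG
  have hγ : γ.comp (toGraded R hem hm) = (AddMonoidHom.mulLeft ((m / e : ℕ) : AdjoinRoot _)).comp
      (AdjoinRoot.mk (cyclotomic e R)).toAddMonoidHom := by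
    ext i r
    change γ (toGraded R hem hm (monomial i r)) = ((m / e : ℕ) : AdjoinRoot _) *
      AdjoinRoot.mk (cyclotomic e R) (monomial i r)
    rw [toGraded_monomial]
    change preGhost R he (X ^ i * C (BigWitt.single m (m / e) r)) = _
    rw [map_mul, preGhost_single he hem, if_pos dvd_rfl, map_pow, preGhost_X, Nat.div_self he0,
      pow_one, ← C_mul_X_pow_eq_monomial, map_mul, map_mul (AdjoinRoot.mk _), map_pow,
      AdjoinRoot.mk_X, AdjoinRoot.mk_C, map_natCast]
    ring
  have h1 : ((m / e : ℕ) : AdjoinRoot _) * AdjoinRoot.mk (cyclotomic e R) h = 0 := by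
    refine (DFunLike.congr_fun hγ h).symm.trans ?_
    change γ (toGraded R hem hm h) = 0
    rw [hh]
    exact h0
  have h2 := natCast_mul_adjoinRoot_eq_zero (cyclotomic.monic e R)
    (Nat.pos_of_mem_divisors (div_mem_divisors he)).ne' h1
  obtain ⟨g, rfl⟩ := AdjoinRoot.mk_eq_zero.mp h2
  rw [toGraded_cyclotomic_mul, eq_comm, QuotientAddGroup.eq_zero_iff] at hh
  exact hh

/-- The `q`-ghost map is injective over domains of characteristic zero. -/
theorem ghost_injective [IsDomain R] [CharZero R] {m : ℕ} (hm : m ≠ 0) :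
    Function.Injective (ghost m R) := by
  rw [injective_iff_map_eq_zero]
  intro c hc
  obtain ⟨F, rfl⟩ := Ideal.Quotient.mk_surjective c
  have h0 : ∀ {e} (he : e ∈ m.divisors), preGhost R he F = 0 := fun he => congrFun hc ⟨_, he⟩
  rw [Ideal.Quotient.eq_zero_iff_mem]
  have key : ∀ n, F ∈ vFil R m (n + 1) → F ∈ vFil R m 1 := by
    intro n
    induction n with
    | zero => exact id
    | succ n ih =>
      intro hF
      by_cases hn : n + 1 ∣ m
      · exact ih (mem_vFil_of_preGhost_eq_zero (Nat.mem_divisors.mpr ⟨hn, hm⟩) hF (h0 _))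
      -- The filtration does not jump at a number that does not divide `m`.
      · refine ih (vFil_induction (fun _ => mem_vFil_of_mem_ideal) (fun d i r hd hdn => ?_)
          (fun _ _ => add_mem) (fun _ => neg_mem) hF)
        refine X_pow_mul_single_mem_vFil hd (lt_of_le_of_ne (Nat.le_of_lt_succ hdn) ?_) i r
        rintro rfl
        exact hn hd
  exact mem_ideal_of_mem_vFil_one hm (key m (mem_vFil_succ_self hm F))

end Injectivity

end QWitt

/-! ### Existence of norms in `q`-ghost coordinates. -/

namespace QWitt

section NormExistence

variable {R : Type*} [CommRing R]

/-- The ring homomorphism `c ↦ c_{(e,m)}(q^{e/(e,m)})` to `R[q]/Φ_e(q)`, for `e ∣ m'`. -/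
noncomputable def normCoord (R : Type*) [CommRing R] {m m' e : ℕ} (h : m ∣ m')
    (he : e ∈ m'.divisors) : QWitt m R →+* AdjoinRoot (cyclotomic e R) :=
  (subst R (Nat.gcd_dvd_left e m) (Nat.pos_of_mem_divisors he)).comp
    (ghostCoord R (gcd_mem_divisors h ⟨e, he⟩))

theorem ghostCoord_C {m e : ℕ} (he : e ∈ m.divisors) (x : BigWitt m R) :
    ghostCoord R he (Ideal.Quotient.mk _ (C x)) = AdjoinRoot.of _ (x.ghost (m / e)) :=
  preGhost_C he x

theorem ghostCoord_X {m e : ℕ} (he : e ∈ m.divisors) :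
    ghostCoord R he (Ideal.Quotient.mk _ X) = AdjoinRoot.root _ :=
  preGhost_X he

theorem subst_of {g e : ℕ} (hge : g ∣ e) (he : 0 < e) (r : R) :
    subst R hge he (AdjoinRoot.of _ r) = AdjoinRoot.of _ r :=
  AdjoinRoot.lift_of _

theorem subst_root {g e : ℕ} (hge : g ∣ e) (he : 0 < e) :
    subst R hge he (AdjoinRoot.root _) = AdjoinRoot.root _ ^ (e / g) :=
  AdjoinRoot.lift_root _

theorem normCoord_C {m m' e : ℕ} (h : m ∣ m') (he : e ∈ m'.divisors) (x : BigWitt m R) :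
    normCoord R h he (Ideal.Quotient.mk _ (C x)) =
      AdjoinRoot.of _ (x.ghost (m / Nat.gcd e m)) := by
  rw [normCoord, RingHom.comp_apply, ghostCoord_C, subst_of]

theorem normCoord_X {m m' e : ℕ} (h : m ∣ m') (he : e ∈ m'.divisors) :
    normCoord R h he (Ideal.Quotient.mk _ X) = AdjoinRoot.root _ ^ (e / Nat.gcd e m) := by
  rw [normCoord, RingHom.comp_apply, ghostCoord_X, subst_root]

/-- The image of `c` under the norm in `q`-ghost coordinates comes from a `q`-Witt vector. -/
def HasNorm {m m' : ℕ} (h : m ∣ m') (c : QWitt m R) : Prop :=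
  ∃ z : QWitt m' R, ∀ (e : ℕ) (he : e ∈ m'.divisors),
    ghostCoord R he z = normCoord R h he c ^ (m' / Nat.lcm e m)

theorem HasNorm.mul {m m' : ℕ} {h : m ∣ m'} {c d : QWitt m R} (hc : HasNorm h c)
    (hd : HasNorm h d) : HasNorm h (c * d) := by
  obtain ⟨y, hy⟩ := hc
  obtain ⟨z, hz⟩ := hd
  exact ⟨y * z, fun e he => by rw [map_mul, hy, hz, map_mul, mul_pow]⟩

theorem hasNorm_of_dvd_trans {m n k : ℕ} (hk : k ≠ 0) (h : m ∣ n) (h' : n ∣ k)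
    (H : ∀ c : QWitt m R, HasNorm h c) (H' : ∀ c : QWitt n R, HasNorm h' c) (c : QWitt m R) :
    HasNorm (h.trans h') c := by
  obtain ⟨y, hy⟩ := H c
  obtain ⟨z, hz⟩ := H' y
  refine ⟨z, fun e he => ?_⟩
  have he0 := Nat.pos_of_mem_divisors he
  have hn0 : 0 < n := Nat.pos_of_dvd_of_pos h' (Nat.pos_of_ne_zero hk)
  have hm0 : 0 < m := Nat.pos_of_dvd_of_pos h hn0
  have hg : Nat.gcd (Nat.gcd e n) m = Nat.gcd e m := by
    rw [Nat.gcd_assoc, Nat.gcd_eq_right h]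
  have hcomp : (subst R (Nat.gcd_dvd_left e n) he0).comp
      (normCoord R h (gcd_mem_divisors h' ⟨e, he⟩)) = normCoord R (h.trans h') he := by
    refine Ideal.Quotient.ringHom_ext (Polynomial.ringHom_ext (fun x => ?_) ?_)
    · simp only [RingHom.comp_apply, normCoord_C, subst_of, hg]
    · simp only [RingHom.comp_apply, normCoord_X, map_pow, subst_root, hg]
      rw [← pow_mul, Nat.div_mul_div_comm (Nat.gcd_dvd_left e n) (hg ▸ Nat.gcd_dvd_left _ m),
        mul_comm e, Nat.mul_div_mul_left _ _ (Nat.gcd_pos_of_pos_left _ he0)]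
  rw [hz, normCoord, RingHom.comp_apply, hy, map_pow, ← RingHom.comp_apply, hcomp, ← pow_mul]
  congr 1
  obtain ⟨a, rfl⟩ := h
  obtain ⟨b, hb⟩ := h'
  have h1 := Nat.gcd_mul_lcm e (m * a)
  have h2 := Nat.gcd_mul_lcm (Nat.gcd e (m * a)) m
  have h3 := Nat.gcd_mul_lcm e m
  rw [hg] at h2
  have hg0 : 0 < Nat.gcd e m := Nat.gcd_pos_of_pos_left _ he0
  have hl1 : Nat.lcm (Nat.gcd e (m * a)) m ∣ m * a :=
    Nat.lcm_dvd (Nat.gcd_dvd_right _ _) (Dvd.intro a rfl)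
  have hl2 : Nat.lcm e (m * a) ∣ k := Nat.lcm_dvd (Nat.dvd_of_mem_divisors he) ⟨b, hb⟩
  have hl3 : Nat.lcm e m ∣ k :=
    Nat.lcm_dvd (Nat.dvd_of_mem_divisors he) ((Dvd.intro a rfl : m ∣ m * a).trans ⟨b, hb⟩)
  obtain ⟨s, hs⟩ := hl1
  obtain ⟨t, ht⟩ := hl2
  obtain ⟨w, hw⟩ := hl3
  have p1 : 0 < Nat.lcm e m := Nat.lcm_pos he0 hm0
  have p2 : 0 < Nat.lcm e (m * a) := Nat.lcm_pos he0 hn0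
  have p3 : 0 < Nat.lcm (Nat.gcd e (m * a)) m := Nat.lcm_pos (Nat.gcd_pos_of_pos_left _ he0) hm0
  rw [Nat.div_eq_of_eq_mul_right p1 hw, Nat.div_eq_of_eq_mul_right p3 hs,
    Nat.div_eq_of_eq_mul_right p2 ht]
  -- The exponents of the two stages are `s` and `t`, and that of the composite is `w`. The equality
  -- `s * t = w` is cleared of denominators and follows from `gcd * lcm = product` for the three
  -- pairs.
  have hne : 0 < Nat.gcd e (m * a) * (Nat.gcd e m * Nat.lcm e m) := by positivity
  refine Nat.eq_of_mul_eq_mul_left hne ?_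
  calc Nat.gcd e (m * a) * (Nat.gcd e m * Nat.lcm e m) * (s * t)
      = e * s * t * (Nat.gcd e (m * a) * m) := by rw [h3]; ring
    _ = e * (Nat.lcm (Nat.gcd e (m * a)) m * s) * t * Nat.gcd e m := by rw [← h2]; ring
    _ = (e * (m * a)) * t * Nat.gcd e m := by rw [← hs]
    _ = Nat.gcd e (m * a) * Nat.gcd e m * (Nat.lcm e (m * a) * t) := by rw [← h1]; ring
    _ = Nat.gcd e (m * a) * (Nat.gcd e m * Nat.lcm e m) * w := by rw [← ht, hw]; ring

/-! ### The case `m' = p * m` with `p` prime. -/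

section Prime

variable {p m : ℕ}

theorem exponent_of_dvd (hm : 0 < m) {e : ℕ} (h : e ∣ m) : p * m / Nat.lcm e m = p := by
  rw [Nat.lcm_eq_right h, Nat.mul_div_cancel _ hm]

/-- Such an `e` carries the full power of `p` in `p * m`. The norm formula at `e` then reads
`c_f(q^p)` with exponent `1`, whereas at `e ∣ m` it reads `c_e(q)^p`. -/
theorem eq_prime_mul_of_not_dvd (hp : p.Prime) {e : ℕ} (h : e ∣ p * m) (hn : ¬ e ∣ m) :
    ∃ f t, e = p * f ∧ m = f * t ∧ ¬ p ∣ t := by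
  obtain ⟨t, ht⟩ := h
  have hpt : ¬ p ∣ t := by
    rintro ⟨s, rfl⟩
    refine hn ⟨s, Nat.eq_of_mul_eq_mul_left hp.pos (ht.trans (by ring))⟩
  obtain ⟨f, rfl⟩ := (hp.dvd_mul.mp (Dvd.intro m ht)).resolve_right hpt
  exact ⟨f, t, rfl, Nat.eq_of_mul_eq_mul_left hp.pos (ht.trans (mul_assoc _ _ _)), hpt⟩

theorem gcd_prime_mul (hp : p.Prime) {f t : ℕ} (ht : ¬ p ∣ t) :
    Nat.gcd (p * f) (f * t) = f := by
  rw [mul_comm p f, Nat.gcd_mul_left, (hp.coprime_iff_not_dvd.mpr ht).gcd_eq_one, mul_one]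

theorem exponent_of_not_dvd (hp : p.Prime) (hm : 0 < m) {e : ℕ} (h : e ∣ p * m) (hn : ¬ e ∣ m) :
    p * m / Nat.lcm e m = 1 := by
  obtain ⟨f, t, rfl, rfl, ht⟩ := eq_prime_mul_of_not_dvd hp h hn
  have hf : 0 < f := Nat.pos_of_mul_pos_right hm
  have := Nat.gcd_mul_lcm (p * f) (f * t)
  rw [gcd_prime_mul hp ht, mul_comm p f, mul_assoc f p] at this
  rw [mul_comm p f, Nat.eq_of_mul_eq_mul_left hf this]
  exact Nat.div_self (Nat.mul_pos hp.pos hm)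

/-- The witness is `V_p` applied to the coefficients of a chosen representative. Only existence is
needed, so compatibility with the ideal is not checked. -/
theorem exists_transfer (p : ℕ) (c : QWitt m R) :
    ∃ z : QWitt (p * m) R, ∀ (e : ℕ) (he : e ∈ (p * m).divisors), ghostCoord R he z =
      if e ∣ m then (p : AdjoinRoot _) * normCoord R (dvd_mul_left m p) he c else 0 := by
  obtain ⟨F, rfl⟩ := Ideal.Quotient.mk_surjective c
  induction F using Polynomial.induction_on' with
  | add F G hF hG =>
    obtain ⟨y, hy⟩ := hF
    obtain ⟨z, hz⟩ := hG
    refine ⟨y + z, fun e he => ?_⟩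
    rw [map_add, hy, hz]
    split_ifs
    · rw [map_add, map_add, mul_add]
    · rw [add_zero]
  | monomial n x =>
    refine ⟨Ideal.Quotient.mk _ (C (BigWitt.verschiebung m (p * m) x) * X ^ n), fun e he => ?_⟩
    have hm := right_ne_zero_of_mul (Nat.mem_divisors.mp he).2
    rw [← C_mul_X_pow_eq_monomial]
    simp only [map_mul, map_pow, ghostCoord_C, ghostCoord_X, normCoord_C, normCoord_X,
      ghost_verschiebung_div he (dvd_mul_left m p)]
    split_ifs with h
    · rw [Nat.gcd_eq_left h, Nat.div_self (Nat.pos_of_mem_divisors he), pow_one,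
        Nat.mul_div_cancel _ (Nat.pos_of_ne_zero hm), map_mul, map_natCast, mul_assoc]
    · rw [map_zero, zero_mul]

/-- At `e ∤ m` the norm is additive. At `e ∣ m` it is a `p`-th power, whose defect of additivity is
`p` times an integral polynomial in `c` and `d`. This is exactly the shape of a transfer. -/
theorem HasNorm.add (hp : p.Prime) (hm : 0 < m) {c d : QWitt m R}
    (hc : HasNorm (dvd_mul_left m p) c) (hd : HasNorm (dvd_mul_left m p) d) :
    HasNorm (dvd_mul_left m p) (c + d) := by
  obtain ⟨y, hy⟩ := hc
  obtain ⟨z, hz⟩ := hd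
  obtain ⟨w, hw⟩ := exists_transfer p
    (c * d * ∑ k ∈ Finset.Ioo 0 p,
      c ^ (k - 1) * d ^ (p - k - 1) * ((p.choose k / p : ℕ) : QWitt m R))
  refine ⟨y + z + w, fun e he => ?_⟩
  rw [map_add, map_add, hy, hz, hw]
  split_ifs with h
  · rw [exponent_of_dvd hm h, map_add, add_pow_prime_eq hp]
    simp only [map_sum, map_mul, map_pow, map_natCast, mul_assoc]
  · rw [exponent_of_not_dvd hp hm (Nat.dvd_of_mem_divisors he) h, map_add]
    ring

theorem hasNorm_zero (hp : p.Prime) (hm : 0 < m) :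
    HasNorm (dvd_mul_left m p) (0 : QWitt m R) := by
  refine ⟨0, fun e he => ?_⟩
  rw [map_zero, map_zero, zero_pow]
  by_cases h : e ∣ m
  · rw [exponent_of_dvd hm h]
    exact hp.ne_zero
  · rw [exponent_of_not_dvd hp hm (Nat.dvd_of_mem_divisors he) h]
    exact one_ne_zero

theorem hasNorm_X (hp : p.Prime) (hm : 0 < m) :
    HasNorm (dvd_mul_left m p) (Ideal.Quotient.mk _ X : QWitt m R) := by
  refine ⟨Ideal.Quotient.mk _ X ^ p, fun e he => ?_⟩
  rw [map_pow, ghostCoord_X, normCoord_X]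
  by_cases h : e ∣ m
  · rw [exponent_of_dvd hm h, Nat.gcd_eq_left h, Nat.div_self (Nat.pos_of_mem_divisors he), pow_one]
  · rw [exponent_of_not_dvd hp hm (Nat.dvd_of_mem_divisors he) h, pow_one]
    obtain ⟨f, t, rfl, rfl, ht⟩ := eq_prime_mul_of_not_dvd hp (Nat.dvd_of_mem_divisors he) h
    rw [gcd_prime_mul hp ht, Nat.mul_div_cancel _ (Nat.pos_of_mul_pos_right hm)]

theorem hasNorm_one {m m' : ℕ} (h : m ∣ m') : HasNorm h (1 : QWitt m R) :=
  ⟨1, fun e he => by rw [map_one, map_one, one_pow]⟩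

theorem HasNorm.pow {m m' : ℕ} {h : m ∣ m'} {c : QWitt m R} (hc : HasNorm h c) (n : ℕ) :
    HasNorm h (c ^ n) := by
  induction n with
  | zero => simpa using hasNorm_one h
  | succ n ih => simpa [pow_succ] using ih.mul hc

/-- The witness is `ε V_k([r]) + j V_{pk}([r^p])` with `k^p = εk + pkj`. At `e ∣ m` with `k ∣ m/e`,
both terms are multiples of the same power of `r`, and the equation matches coefficients. If `k`
divides `p * (m/e)` but not `m/e`, then `p ∣ k` and the value must be zero, so `ε = 0`. At `e ∤ m`
the second term vanishes, and a nonzero indicator forces `p ∤ k`, so `ε = 1`. -/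
theorem hasNorm_single (hp : p.Prime) (hm : 0 < m) {k : ℕ} (hk : 0 < k) (r : R) :
    HasNorm (dvd_mul_left m p) (Ideal.Quotient.mk _ (C (BigWitt.single m k r)) : QWitt m R) := by
  obtain ⟨ε, j, hε, hj⟩ : ∃ ε j : ℕ, ε = (if p ∣ k then 0 else 1) ∧ k ^ p = ε * k + p * k * j := by
    split_ifs with h
    · obtain ⟨l, rfl⟩ := h
      refine ⟨0, (p * l) ^ (p - 2) * l, rfl, ?_⟩
      obtain ⟨q, rfl⟩ := Nat.exists_eq_add_of_le hp.two_le
      rw [Nat.add_sub_cancel_left]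
      ring
    -- For `p ∤ k`, Fermat's little theorem gives `k^(p-1) = 1 + p * j`.
    · refine ⟨1, ?_⟩
      have h1 : 1 ≡ k ^ (p - 1) [MOD p] := by
        have := Nat.ModEq.pow_totient ((hp.coprime_iff_not_dvd.mpr h).symm)
        rw [Nat.totient_prime hp] at this
        exact this.symm
      obtain ⟨j, hj⟩ := (Nat.modEq_iff_dvd' (Nat.one_le_pow _ _ hk)).mp h1
      refine ⟨j, rfl, ?_⟩
      have h2 : k ^ (p - 1) = 1 + p * j := by
        have := Nat.one_le_pow (p - 1) k hk
        omega
      rw [← Nat.sub_add_cancel hp.one_le, pow_succ, h2, Nat.sub_add_cancel hp.one_le]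
      ring
  refine ⟨Ideal.Quotient.mk _ (ε * C (BigWitt.single (p * m) k r) +
    j * C (BigWitt.single (p * m) (p * k) (r ^ p))), fun e he => ?_⟩
  have hmd : m / Nat.gcd e m ∈ m.divisors :=
    div_mem_divisors (gcd_mem_divisors (dvd_mul_left m p) ⟨e, he⟩)
  simp only [map_add, map_mul, map_natCast, ghostCoord_C, normCoord_C,
    BigWitt.ghost_single _ _ (div_mem_divisors he), BigWitt.ghost_single _ _ hmd]
  rw [← map_natCast (AdjoinRoot.of (cyclotomic e R)), ← map_natCast (AdjoinRoot.of (cyclotomic e R)),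
    ← map_mul, ← map_mul, ← map_add, ← map_pow]
  congr 1
  by_cases h : e ∣ m
  · obtain ⟨s, rfl⟩ := h
    have he0 := Nat.pos_of_mem_divisors he
    rw [exponent_of_dvd hm (Dvd.intro s rfl), Nat.gcd_eq_left (Dvd.intro s rfl),
      mul_left_comm p e s, Nat.mul_div_cancel_left _ he0, Nat.mul_div_cancel_left _ he0]
    by_cases hks : k ∣ s
    · obtain ⟨u, rfl⟩ := hks
      have hj' : (k : R) ^ p = ε * k + p * k * j := by exact_mod_cast congrArg (Nat.cast (R := R)) hj
      rw [if_pos (Dvd.intro u rfl), if_pos ((Dvd.intro u rfl).mul_left p),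
        if_pos (Nat.mul_dvd_mul_left p (Dvd.intro u rfl)), mul_left_comm p k u,
        Nat.mul_div_cancel_left _ hk, Nat.mul_div_cancel_left _ hk, mul_left_comm k p u,
        ← mul_assoc p k u, Nat.mul_div_cancel_left _ (Nat.mul_pos hp.pos hk), mul_pow, hj', ← pow_mul,
        ← pow_mul, mul_comm u p]
      push_cast
      ring
    · rw [if_neg hks, if_neg (fun h' => hks (Nat.dvd_of_mul_dvd_mul_left hp.pos h')), mul_zero,
        add_zero, zero_pow hp.ne_zero, hε]
      by_cases hpk : p ∣ k
      · rw [if_pos hpk, Nat.cast_zero, zero_mul]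
      · rw [if_neg (fun h' => hks
          ((hp.coprime_iff_not_dvd.mpr hpk).symm.dvd_of_dvd_mul_left h')), mul_zero]
  · rw [exponent_of_not_dvd hp hm (Nat.dvd_of_mem_divisors he) h, pow_one]
    obtain ⟨f, t, rfl, rfl, ht⟩ := eq_prime_mul_of_not_dvd hp (Nat.dvd_of_mem_divisors he) h
    have hf := Nat.pos_of_mul_pos_right hm
    rw [gcd_prime_mul hp ht, Nat.mul_div_cancel_left _ hf, ← mul_assoc,
      Nat.mul_div_cancel_left _ (Nat.mul_pos hp.pos hf),
      if_neg (fun h' : p * k ∣ t => ht (dvd_of_mul_right_dvd h')), mul_zero, add_zero]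
    by_cases hkt : k ∣ t
    · rw [if_pos hkt, hε, if_neg (fun h' => ht (h'.trans hkt)), Nat.cast_one, one_mul]
    · rw [if_neg hkt, mul_zero]

theorem hasNorm_prime_mul (hp : p.Prime) (hm : 0 < m) (c : QWitt m R) :
    HasNorm (dvd_mul_left m p) c := by
  obtain ⟨F, rfl⟩ := Ideal.Quotient.mk_surjective c
  induction F using Polynomial.induction_on' with
  | add F G hF hG =>
    rw [map_add]
    exact hF.add hp hm hG
  | monomial n x =>
    rw [← C_mul_X_pow_eq_monomial, map_mul, map_pow]
    refine HasNorm.mul ?_ ((hasNorm_X hp hm).pow n)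
    rw [BigWitt.eq_sum_single x, map_sum, map_sum]
    refine Finset.sum_induction _ (HasNorm (dvd_mul_left m p)) (fun a b ha hb => ha.add hp hm hb)
      (hasNorm_zero hp hm) fun d hd => hasNorm_single hp hm (Nat.pos_of_mem_divisors hd) _

end Prime

theorem hasNorm_self {m : ℕ} (h : m ∣ m) (hm : 0 < m) (c : QWitt m R) : HasNorm h c := by
  refine ⟨c, fun e he => ?_⟩
  have hem := Nat.dvd_of_mem_divisors he
  rw [Nat.lcm_eq_right hem, Nat.div_self hm, pow_one]
  refine DFunLike.congr_fun (?_ : ghostCoord R he = normCoord R h he) c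
  refine Ideal.Quotient.ringHom_ext (Polynomial.ringHom_ext (fun x => ?_) ?_)
  · simp only [RingHom.comp_apply, ghostCoord_C, normCoord_C, Nat.gcd_eq_left hem]
  · simp only [RingHom.comp_apply, ghostCoord_X, normCoord_X, Nat.gcd_eq_left hem,
      Nat.div_self (Nat.pos_of_mem_divisors he), pow_one]

theorem hasNorm {m m' : ℕ} (hm' : m' ≠ 0) (h : m ∣ m') (c : QWitt m R) : HasNorm h c := by
  obtain ⟨k, hk⟩ := id h
  rw [mul_comm] at hk
  -- Multiplicative induction on `m'/m`: transitivity handles products, leaving primes.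
  induction k using Nat.recOnMul generalizing m m' with
  | zero => simp [hk] at hm'
  | one =>
    rw [one_mul] at hk
    subst hk
    exact hasNorm_self h (Nat.pos_of_ne_zero hm') c
  | prime p hp =>
    subst hk
    exact hasNorm_prime_mul hp (Nat.pos_of_ne_zero (right_ne_zero_of_mul hm')) c
  | mul a b ha hb =>
    rw [mul_assoc] at hk
    subst hk
    have hbm := right_ne_zero_of_mul hm'
    exact hasNorm_of_dvd_trans hm' (dvd_mul_left m b) (dvd_mul_left (b * m) a)
      (fun c => hb hbm _ c rfl) (fun c => ha hm' _ c rfl) c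

end NormExistence

end QWitt

/-! ### Functoriality and surjections of coefficient rings. -/

namespace QWitt

section Naturality

variable {R S T : Type*} [CommRing R] [CommRing S] [CommRing T]

theorem map_mk {m : ℕ} (f : R →+* S) (F : (BigWitt m R)[X]) :
    map m f (Ideal.Quotient.mk _ F) = Ideal.Quotient.mk _ (F.map (BigWitt.map m f)) :=
  Ideal.quotientMap_mk

theorem map_comp_apply {m : ℕ} (g : S →+* T) (f : R →+* S) (c : QWitt m R) :
    map m (g.comp f) c = map m g (map m f c) := by
  obtain ⟨F, rfl⟩ := Ideal.Quotient.mk_surjective c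
  rw [map_mk, map_mk, map_mk, Polynomial.map_map]
  rfl

theorem map_id_apply {m : ℕ} (c : QWitt m R) : map m (RingHom.id R) c = c := by
  obtain ⟨F, rfl⟩ := Ideal.Quotient.mk_surjective c
  rw [map_mk]
  exact congrArg _ Polynomial.map_id

/-- The map `R[q]/Φ_e(q) → S[q]/Φ_e(q)` induced by a ring homomorphism `R → S`. -/
noncomputable def cyclotomicMap (e : ℕ) (f : R →+* S) :
    AdjoinRoot (cyclotomic e R) →+* AdjoinRoot (cyclotomic e S) :=
  AdjoinRoot.map f _ _ (by rw [map_cyclotomic])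

theorem cyclotomicMap_of (e : ℕ) (f : R →+* S) (r : R) :
    cyclotomicMap e f (AdjoinRoot.of _ r) = AdjoinRoot.of _ (f r) :=
  AdjoinRoot.map_of ..

theorem cyclotomicMap_root (e : ℕ) (f : R →+* S) :
    cyclotomicMap e f (AdjoinRoot.root _) = AdjoinRoot.root _ :=
  AdjoinRoot.map_root ..

theorem ghostCoord_map {m e : ℕ} (he : e ∈ m.divisors) (f : R →+* S) (c : QWitt m R) :
    ghostCoord S he (map m f c) = cyclotomicMap e f (ghostCoord R he c) := by
  refine DFunLike.congr_fun (?_ : (ghostCoord S he).comp (map m f) =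
    (cyclotomicMap e f).comp (ghostCoord R he)) c
  refine Ideal.Quotient.ringHom_ext (Polynomial.ringHom_ext (fun x => ?_) ?_)
  · simp only [RingHom.comp_apply, map_mk, Polynomial.map_C, ghostCoord_C, cyclotomicMap_of,
      BigWitt.ghost_map]
  · simp only [RingHom.comp_apply, map_mk, Polynomial.map_X, ghostCoord_X, cyclotomicMap_root]

theorem normCoord_map {m m' e : ℕ} (h : m ∣ m') (he : e ∈ m'.divisors) (f : R →+* S)
    (c : QWitt m R) : normCoord S h he (map m f c) = cyclotomicMap e f (normCoord R h he c) := by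
  refine DFunLike.congr_fun (?_ : (normCoord S h he).comp (map m f) =
    (cyclotomicMap e f).comp (normCoord R h he)) c
  refine Ideal.Quotient.ringHom_ext (Polynomial.ringHom_ext (fun x => ?_) ?_)
  · simp only [RingHom.comp_apply, map_mk, Polynomial.map_C, normCoord_C, cyclotomicMap_of,
      BigWitt.ghost_map]
  · simp only [RingHom.comp_apply, map_mk, Polynomial.map_X, normCoord_X, cyclotomicMap_root,
      map_pow]

theorem ghostNorm_ghost_apply {m m' : ℕ} (h : m ∣ m') (c : QWitt m R) (e : m'.divisors) :
    ghostNorm R h (ghost m R c) e = normCoord R h e.2 c ^ (m' / Nat.lcm e m) := rfl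

theorem ghost_eq_ghostNorm_iff {m m' : ℕ} (h : m ∣ m') (c : QWitt m R) (z : QWitt m' R) :
    ghost m' R z = ghostNorm R h (ghost m R c) ↔ ∀ (e : ℕ) (he : e ∈ m'.divisors),
      ghostCoord R he z = normCoord R h he c ^ (m' / Nat.lcm e m) :=
  ⟨fun H e he => congrFun H ⟨e, he⟩, fun H => funext fun e => H e e.2⟩

theorem ghost_map_of_ghost_eq {m m' : ℕ} (h : m ∣ m') (f : R →+* S) {c : QWitt m R}
    {z : QWitt m' R} (H : ghost m' R z = ghostNorm R h (ghost m R c)) :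
    ghost m' S (map m' f z) = ghostNorm S h (ghost m S (map m f c)) := by
  rw [ghost_eq_ghostNorm_iff] at H ⊢
  intro e he
  rw [ghostCoord_map, normCoord_map, H, map_pow]

theorem bigWittMap_surjective {m : ℕ} {f : R →+* S} (hf : Function.Surjective f) :
    Function.Surjective (BigWitt.map m f) := by
  intro x
  choose g hg using hf
  refine ⟨BigWitt.ofFun m fun e => g (x.coeff e), BigWitt.ext_coeff fun e he => ?_⟩
  rw [BigWitt.coeff_map, BigWitt.coeff_ofFun _ he, hg]

theorem map_surjective {m : ℕ} {f : R →+* S} (hf : Function.Surjective f) :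
    Function.Surjective (map m f) := by
  intro c
  obtain ⟨F, rfl⟩ := Ideal.Quotient.mk_surjective c
  obtain ⟨G, rfl⟩ := Polynomial.map_surjective _ (bigWittMap_surjective hf) F
  exact ⟨Ideal.Quotient.mk _ G, map_mk f G⟩

/-- The generators are indexed by Witt vectors, which lift along `f`, so every relation over `S`
comes from one over `R`. -/
theorem qWittIdeal_le_map {m : ℕ} {f : R →+* S} (hf : Function.Surjective f) :
    qWittIdeal m S ≤ (qWittIdeal m R).map (mapRingHom (BigWitt.map m f)) := by
  conv_lhs => rw [qWittIdeal]
  rw [Ideal.span_le]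
  rintro _ (⟨e, he, x, rfl⟩ | ⟨d, e, hde, he, x, rfl⟩)
  · obtain ⟨x, rfl⟩ := bigWittMap_surjective hf x
    have := Ideal.mem_map_of_mem (I := qWittIdeal m R) (mapRingHom (BigWitt.map m f))
      (Ideal.subset_span (Or.inl ⟨e, he, x, rfl⟩))
    simpa [BigWitt.map_verschiebung] using this
  · obtain ⟨x, rfl⟩ := bigWittMap_surjective hf x
    have := Ideal.mem_map_of_mem (I := qWittIdeal m R) (mapRingHom (BigWitt.map m f))
      (Ideal.subset_span (Or.inr ⟨d, e, hde, he, x, rfl⟩))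
    simpa [BigWitt.map_verschiebung, BigWitt.map_frobenius, Polynomial.map_sum] using this

/-- Relations lift, so the ambiguity of a lift can be represented by a polynomial `K` whose
coefficients have all Witt coordinates in `ker f`. -/
theorem exists_map_eq_zero_of_map_eq {m : ℕ} {f : R →+* S} (hf : Function.Surjective f)
    {c d : QWitt m R} (h : map m f c = map m f d) : ∃ K : (BigWitt m R)[X],
      K.map (BigWitt.map m f) = 0 ∧ c = d + Ideal.Quotient.mk _ K := by
  obtain ⟨F, rfl⟩ := Ideal.Quotient.mk_surjective c
  obtain ⟨G, rfl⟩ := Ideal.Quotient.mk_surjective d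
  rw [map_mk, map_mk, Ideal.Quotient.eq, ← Polynomial.map_sub] at h
  obtain ⟨H, hH, hHF⟩ := (Ideal.mem_map_iff_of_surjective _
    (Polynomial.map_surjective _ (bigWittMap_surjective hf))).mp (qWittIdeal_le_map hf h)
  refine ⟨F - G - H, ?_, ?_⟩
  · rw [Polynomial.map_sub, ← hHF, coe_mapRingHom, sub_self]
  · rw [map_sub, map_sub, Ideal.Quotient.eq_zero_iff_mem.mpr hH]
    ring

end Naturality

/-! ### Construction of the norm by descent from polynomial rings over `ℤ`. -/

section Norm

variable {m m' : ℕ} {R S : Type*} [CommRing R] [CommRing S]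

/-- A preimage under the `q`-ghost map of the norm of `c` in `q`-ghost coordinates. It is unique
over domains of characteristic zero. -/
noncomputable def preNorm (hm' : m' ≠ 0) (h : m ∣ m') (c : QWitt m R) :
    QWitt m' R :=
  (hasNorm hm' h c).choose

theorem ghost_preNorm (hm' : m' ≠ 0) (h : m ∣ m') (c : QWitt m R) :
    ghost m' R (preNorm hm' h c) = ghostNorm R h (ghost m R c) :=
  (ghost_eq_ghostNorm_iff h c _).mpr (hasNorm hm' h c).choose_spec

theorem eq_preNorm [IsDomain R] [CharZero R] (hm' : m' ≠ 0) (h : m ∣ m') {c : QWitt m R}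
    {z : QWitt m' R} (H : ghost m' R z = ghostNorm R h (ghost m R c)) : z = preNorm hm' h c :=
  ghost_injective hm' (H.trans (ghost_preNorm hm' h c).symm)

theorem map_preNorm [IsDomain S] [CharZero S] (hm' : m' ≠ 0) (h : m ∣ m') (f : R →+* S)
    (c : QWitt m R) : map m' f (preNorm hm' h c) = preNorm hm' h (map m f c) :=
  eq_preNorm hm' h (ghost_map_of_ghost_eq h f (ghost_preNorm hm' h c))

theorem preNorm_mul [IsDomain R] [CharZero R] (hm' : m' ≠ 0) (h : m ∣ m') (c d : QWitt m R) :
    preNorm hm' h c * preNorm hm' h d = preNorm hm' h (c * d) := by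
  refine eq_preNorm hm' h (funext fun e => ?_)
  rw [map_mul, Pi.mul_apply, ghost_preNorm, ghost_preNorm, ghostNorm_ghost_apply,
    ghostNorm_ghost_apply, ghostNorm_ghost_apply, map_mul, mul_pow]

theorem preNorm_one [IsDomain R] [CharZero R] (hm' : m' ≠ 0) (h : m ∣ m') :
    1 = preNorm hm' h (1 : QWitt m R) := by
  refine eq_preNorm hm' h (funext fun e => ?_)
  rw [map_one, ghostNorm_ghost_apply, map_one, one_pow, Pi.one_apply]

/-- Over a polynomial ring, the image of the norm of `c` under a surjection depends only on the
image of `c`. -/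
theorem map_preNorm_congr {σ : Type*} (hm' : m' ≠ 0) (h : m ∣ m') {π : MvPolynomial σ ℤ →+* R}
    (hπ : Function.Surjective π) {c d : QWitt m (MvPolynomial σ ℤ)} (H : map m π c = map m π d) :
    map m' π (preNorm hm' h c) = map m' π (preNorm hm' h d) := by
  classical
  obtain ⟨K, hK, rfl⟩ := exists_map_eq_zero_of_map_eq hπ H
  -- A new variable is adjoined for every polynomial `P`. It specialises to `P` under `f₁`, and
  -- under `f₀` to `0` if `P ∈ ker π` and to `P` otherwise. Hence `π ∘ f₁ = π ∘ f₀`, while `f₀`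
  -- kills every variable used to parametrise `K`.
  let f₁ : MvPolynomial (σ ⊕ MvPolynomial σ ℤ) ℤ →+* MvPolynomial σ ℤ :=
    MvPolynomial.eval₂Hom MvPolynomial.C (Sum.elim MvPolynomial.X id)
  let f₀ : MvPolynomial (σ ⊕ MvPolynomial σ ℤ) ℤ →+* MvPolynomial σ ℤ :=
    MvPolynomial.eval₂Hom MvPolynomial.C
      (Sum.elim MvPolynomial.X fun P => if π P = 0 then 0 else P)
  let i : MvPolynomial σ ℤ →+* MvPolynomial (σ ⊕ MvPolynomial σ ℤ) ℤ :=
    (MvPolynomial.rename Sum.inl : MvPolynomial σ ℤ →ₐ[ℤ] _).toRingHom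
  have hf₁i : f₁.comp i = RingHom.id _ :=
    MvPolynomial.ringHom_ext (fun _ => by simp [f₁, i]) (fun _ => by simp [f₁, i])
  have hf₀i : f₀.comp i = RingHom.id _ :=
    MvPolynomial.ringHom_ext (fun _ => by simp [f₀, i]) (fun _ => by simp [f₀, i])
  have hπf : π.comp f₁ = π.comp f₀ := by
    refine MvPolynomial.ringHom_ext (fun _ => by simp [f₁, f₀]) (fun x => ?_)
    rcases x with s | P
    · simp [f₁, f₀]
    · by_cases hP : π P = 0 <;> simp [f₁, f₀, hP]
  let s : BigWitt m (MvPolynomial σ ℤ) → BigWitt m (MvPolynomial (σ ⊕ MvPolynomial σ ℤ) ℤ) :=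
    fun x => BigWitt.ofFun m fun e => MvPolynomial.X (Sum.inr (x.coeff e))
  have hs₁ : ∀ x, BigWitt.map m f₁ (s x) = x := fun x => BigWitt.ext_coeff fun e he => by
    simp [s, f₁, BigWitt.coeff_map, BigWitt.coeff_ofFun _ he]
  have hs₀ : ∀ n, BigWitt.map m f₀ (s (K.coeff n)) = 0 := fun n =>
    BigWitt.ext_coeff fun e he => by
      have h0 : BigWitt.map m π (K.coeff n) = 0 := by
        rw [← Polynomial.coeff_map, hK, Polynomial.coeff_zero]
      have h1 : π ((K.coeff n).coeff e) = 0 := by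
        rw [← BigWitt.coeff_map, h0]
        exact BigWitt.coeff_ofFun _ he
      rw [BigWitt.coeff_map, BigWitt.coeff_ofFun _ he]
      refine Eq.trans ?_ (BigWitt.coeff_ofFun (fun _ => 0) he).symm
      simp [f₀, h1]
  let L : (BigWitt m (MvPolynomial (σ ⊕ MvPolynomial σ ℤ) ℤ))[X] :=
    ∑ n ∈ K.support, monomial n (s (K.coeff n))
  have hL₁ : L.map (BigWitt.map m f₁) = K := by
    simp only [L, Polynomial.map_sum, map_monomial, hs₁]
    exact K.as_sum_support.symm
  have hL₀ : L.map (BigWitt.map m f₀) = 0 := by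
    simp only [L, Polynomial.map_sum, map_monomial, hs₀, map_zero, Finset.sum_const_zero]
  -- One vector with specialisations `d + K` and `d`. Naturality of `preNorm` along `f₁` and `f₀`
  -- presents both sides as images of `preNorm y` under the same map.
  let y : QWitt m (MvPolynomial (σ ⊕ MvPolynomial σ ℤ) ℤ) := map m i d + Ideal.Quotient.mk _ L
  have hy₁ : map m f₁ y = d + Ideal.Quotient.mk _ K := by
    rw [map_add, ← map_comp_apply, hf₁i, map_id_apply, map_mk, hL₁]
  have hy₀ : map m f₀ y = d := by
    rw [map_add, ← map_comp_apply, hf₀i, map_id_apply, map_mk, hL₀, map_zero, add_zero]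
  rw [← hy₁, ← map_preNorm, ← map_comp_apply, hπf, map_comp_apply, map_preNorm, hy₀]

theorem cover_surjective : Function.Surjective (BigWitt.cover R) :=
  fun r => ⟨MvPolynomial.X r, by simp [BigWitt.cover]⟩

/-- A lift of a `q`-Witt vector to the tautological polynomial ring over `ℤ`. -/
noncomputable def coverLift (c : QWitt m R) : QWitt m (MvPolynomial R ℤ) :=
  (map_surjective cover_surjective c).choose

theorem map_coverLift (c : QWitt m R) : map m (BigWitt.cover R) (coverLift c) = c :=
  (map_surjective cover_surjective c).choose_spec

/-- The cyclotomic norm. -/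
noncomputable def norm (R : Type*) [CommRing R] (hm' : m' ≠ 0) (h : m ∣ m') :
    QWitt m R →* QWitt m' R where
  toFun c := map m' (BigWitt.cover R) (preNorm hm' h (coverLift c))
  map_one' := by
    rw [← map_one (map m' (BigWitt.cover R)), preNorm_one hm' h]
    exact map_preNorm_congr hm' h cover_surjective (by rw [map_coverLift, map_one])
  map_mul' c d := by
    rw [← map_mul, preNorm_mul]
    exact map_preNorm_congr hm' h cover_surjective (by simp only [map_mul, map_coverLift])

/-- Frees the norm from the arbitrary choice made in `coverLift`. -/
theorem norm_map_cover (hm' : m' ≠ 0) (h : m ∣ m') (c : QWitt m (MvPolynomial R ℤ)) :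
    norm R hm' h (map m (BigWitt.cover R) c) = map m' (BigWitt.cover R) (preNorm hm' h c) :=
  map_preNorm_congr hm' h cover_surjective (map_coverLift _)

theorem map_norm (hm' : m' ≠ 0) (h : m ∣ m') (f : R →+* S) (c : QWitt m R) :
    map m' f (norm R hm' h c) = norm S hm' h (map m f c) := by
  let g : MvPolynomial R ℤ →+* MvPolynomial S ℤ :=
    (MvPolynomial.rename f : MvPolynomial R ℤ →ₐ[ℤ] _).toRingHom
  have hg : f.comp (BigWitt.cover R) = (BigWitt.cover S).comp g :=
    MvPolynomial.ringHom_ext (fun _ => by simp [g, BigWitt.cover])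
      (fun _ => by simp [g, BigWitt.cover])
  obtain ⟨c, rfl⟩ := map_surjective cover_surjective c
  rw [norm_map_cover, ← map_comp_apply, ← map_comp_apply, hg, map_comp_apply, map_comp_apply,
    norm_map_cover, map_preNorm]

theorem ghost_norm (hm' : m' ≠ 0) (h : m ∣ m') (c : QWitt m R) :
    ghost m' R (norm R hm' h c) = ghostNorm R h (ghost m R c) := by
  obtain ⟨c, rfl⟩ := map_surjective cover_surjective c
  rw [norm_map_cover]
  exact ghost_map_of_ghost_eq h _ (ghost_preNorm hm' h c)

end Norm

end QWitt

theorem mainTheorem4 (m m' : ℕ) (hm' : 0 < m') (h : m ∣ m') :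
    ∃ N : ∀ (R : Type u) [CommRing R], QWitt m R →* QWitt m' R,
      ((∀ (R S : Type u) [CommRing R] [CommRing S] (f : R →+* S) (c : QWitt m R),
          QWitt.map m' f (N R c) = N S (QWitt.map m f c)) ∧
        ∀ (R : Type u) [CommRing R] (c : QWitt m R),
          QWitt.ghost m' R (N R c) = QWitt.ghostNorm R h (QWitt.ghost m R c)) ∧
      ∀ N' : ∀ (R : Type u) [CommRing R], QWitt m R → QWitt m' R,
        (∀ (R S : Type u) [CommRing R] [CommRing S] (f : R →+* S) (c : QWitt m R),
          QWitt.map m' f (N' R c) = N' S (QWitt.map m f c)) →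
        (∀ (R : Type u) [CommRing R] (c : QWitt m R),
          QWitt.ghost m' R (N' R c) = QWitt.ghostNorm R h (QWitt.ghost m R c)) →
        ∀ (R : Type u) [CommRing R] (c : QWitt m R), N' R c = N R c := by
  refine ⟨fun R _ => QWitt.norm R hm'.ne' h, ⟨fun R S _ _ f c => QWitt.map_norm hm'.ne' h f c,
    fun R _ c => QWitt.ghost_norm hm'.ne' h c⟩, fun N' hmap hghost R _ c => ?_⟩
  -- Uniqueness: by naturality, `N'` is determined by its values over the polynomial ring, and there
  -- the ghost formula determines them.
  obtain ⟨c, rfl⟩ := QWitt.map_surjective QWitt.cover_surjective c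
  rw [← hmap, QWitt.norm_map_cover, ← QWitt.eq_preNorm hm'.ne' h (hghost _ c)]
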